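/- Let $V:\mathbb R^d\to\mathbb R^d$ be a measurable operator, $\mathcal X^*=\{x: V(x)=0\}$, and let $R\in\mathbb R$, $\lambda\ge 0$, $\mu>0$, $\sigma>0$. Assume: (1) there is a point of $\mathcal X^*$ of norm at most $R$; (2) for some $x^*\in\mathcal X^*$, $\langle V(x),x-x^*\rangle\ge\mu\|x-x^*\|^2-\lambda$ for all $x\in\mathbb R^d$; (3) in the case of SGDA, $\|V(x)\|\le G(1+\|x\|)$ for all $x$, with $G>0$; in the case of SEG, $V$ is $L$-Lipschitz; (4) the noises $U_n(\cdot)$, $n\in\mathbb N$ (for SEG: $U_n(\cdot)$ and $U_{n+1/2}(\cdot)$, $n\in\mathbb N$) are independent, identically distributed, jointly measurable random fields $\mathbb R^d\to\mathbb R^d$ on a probability space with a filtration $(\mathcal F_n)$; $U_n$ (and $U_{n+1/2}$) is $\mathcal F_{n+1}$-measurable, and for every $x$ the variable $W=U_n(x)$ (and $W=U_{n+1/2}(x)$) is square-integrable with $\mathbb E[W\mid\mathcal F_n]=0$ and $\mathbb E[\|W\|^2\mid\mathcal F_n]\le\sigma^2$; (5) each of these noise fields $U$ decomposes as $U(x)=U^a(x)+U^b(x)$,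 where for each $x$ the variables $U^a(x)$ and $U^b(x)$ are independent and $U^a(x)$ has a Lebesgue density $p_x$, such that $\inf_{x\in C}p_x(t)>0$ for every bounded $C\subseteq\mathbb R^d$ and every $t\in\mathbb R^d$. Consider, from a deterministic starting point $x_0$, the iterates SGDA: $x_{n+1}=x_n-\gamma\,(V(x_n)+U_n(x_n))$, with $0<\gamma<\mu/G^2$; or SEG: $x_{n+1/2}=x_n-\gamma\,(V(x_n)+U_n(x_n))$, $x_{n+1}=x_n-\alpha\gamma\,(V(x_{n+1/2})+U_{n+1/2}(x_{n+1/2}))$, with $0<\gamma<\frac1{2\mu+\sqrt3L}$ and $\alpha\in(0,1)$. Then for each of the two algorithms: (i) the Markov chain $(x_n)$ has a unique stationary distribution $\pi_\gamma$, and $\int\|x\|^2\,d\pi_\gamma<\infty$. (ii) For every measurable $\ell:\mathbb R^d\to\mathbb R$ with $|\ell(x)|\le G_\ell(1+\|x\|)$ for all $x$ and some $G_\ell>0$, all the expectations below are finite, and there is $\rho\in(0,1)$, independent of $x_0$, such that for every $x_0$ there is $c\in(0,\infty)$ with $$\bigl|\mathbb E[\ell(x_n)]-\mathbb E_{x\sim\pi_\gamma}[\ell(x)]\bigr|\le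 c\,\rho^n\qquad\text{for all } n\ge0.$$ Moreover the law of $x_n$ converges geometrically to $\pi_\gamma$ in total variation: there is $\rho\in(0,1)$ such that for every $x_0$ there is $c\in(0,\infty)$ with $d_{TV}(\mathrm{law}(x_n),\pi_\gamma)\le c\,\rho^n$ for all $n\ge0$. (iii) For every $L_\ell$-Lipschitz $\ell:\mathbb R^d\to\mathbb R$ and every $x^*\in\mathcal X^*$, $$\bigl|\mathbb E_{x\sim\pi_\gamma}[\ell(x)]-\ell(x^*)\bigr|\le L_\ell\sqrt D,\qquad D=K\,\frac{\max(\lambda,\gamma)}{\mu},$$ where the constant $K>0$ depends only on $G,R,\sigma$ for SGDA and only on $\alpha,\sigma$ for SEG (in particular not on $\lambda,\mu,\gamma$). -/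

import Mathlib

open MeasureTheory ProbabilityTheory
open scoped ENNReal NNReal

universe u

noncomputable section

namespace StochVI

/-- `ℝ^d` with its Euclidean norm. -/
abbrev Vec (d : ℕ) : Type := EuclideanSpace ℝ (Fin d)

/-- Solutions of the unconstrained variational inequality: the zeros of the operator. -/
def solutions {d : ℕ} (V : Vec d → Vec d) : Set (Vec d) := {x | V x = 0}

/-- `lam`-weak `μ`-quasi strong monotonicity, with respect to some solution. -/
def WeakQuasiStronglyMonotone {d : ℕ} (V : Vec d → Vec d) (lam μ : ℝ) : Prop :=
  ∃ xs ∈ solutions V, ∀ x, μ * ‖x - xs‖ ^ 2 - lam ≤ inner ℝ (V x) (x - xs)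

/-- At most `G`-linear growth. -/
def LinearGrowth {d : ℕ} (V : Vec d → Vec d) (G : ℝ) : Prop :=
  ∀ x, ‖V x‖ ≤ G * (1 + ‖x‖)

/-- A family `U k` of independent, identically distributed measurable random fields on `ℝ^d`.
The fields carry independent σ-algebras, and `U k` is jointly measurable in the point and in the
information of its own σ-algebra, so that evaluating it at an independent random point makes sense.
Equality in law is equality of the laws of the processes `(U k x)_x`. -/
structure IIDFields {d : ℕ} {κ Ω : Type*} [MeasurableSpace Ω] (P : Measure Ω)
    (U : κ → Vec d → Ω → Vec d) : Prop where
  indep : ∃ 𝒢 : κ → MeasurableSpace Ω, (∀ k, 𝒢 k ≤ ‹MeasurableSpace Ω›) ∧ iIndep 𝒢 P ∧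
    ∀ k, Measurable[MeasurableSpace.prod inferInstance (𝒢 k)]
      (fun q : Vec d × Ω => U k q.1 q.2)
  ident : ∀ k l, IdentDistrib (fun ω x => U k x ω) (fun ω x => U l x ω) P P

/-- The noise of a stochastic oracle.  The queries are indexed by `κ`; the `k`-th query is made
on the basis of the history `ℱ (time k)`, and its answer is known at time `time k + 1`. -/
structure OracleNoise {d : ℕ} {κ Ω : Type*} [mΩ : MeasurableSpace Ω] (P : Measure Ω)
    (ℱ : Filtration ℕ mΩ) (time : κ → ℕ) (U : κ → Vec d → Ω → Vec d) (σ : ℝ) : Prop where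
  iid : IIDFields P U
  adapted : ∀ k, Measurable[MeasurableSpace.prod inferInstance (ℱ (time k + 1))]
    (fun q : Vec d × Ω => U k q.1 q.2)
  sq_integrable : ∀ k x, MemLp (U k x) 2 P
  zero_mean : ∀ k x, P[U k x | ℱ (time k)] =ᵐ[P] 0
  second_moment : ∀ k x, P[fun ω => ‖U k x ω‖ ^ 2 | ℱ (time k)] ≤ᵐ[P] fun _ => σ ^ 2

/-- Every field splits pointwise as `Ua x + Ub x` with `Ua x`, `Ub x` independent, where `Ua x` has
a Lebesgue density `p x`, and on each bounded set of points `x` the densities are bounded below at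
each `t` by a positive number. -/
def PositiveDensityPart {d : ℕ} {κ Ω : Type*} [MeasurableSpace Ω] (P : Measure Ω)
    (U : κ → Vec d → Ω → Vec d) : Prop :=
  ∀ k, ∃ (Ua Ub : Vec d → Ω → Vec d) (p : Vec d → Vec d → ℝ≥0∞),
    (∀ x ω, U k x ω = Ua x ω + Ub x ω) ∧
    (∀ x, Measurable (Ua x) ∧ IndepFun (Ua x) (Ub x) P) ∧
    (∀ x, Measurable (p x) ∧ P.map (Ua x) = volume.withDensity (p x)) ∧
    ∀ C : Set (Vec d), Bornology.IsBounded C → ∀ t, 0 < ⨅ x ∈ C, p x t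

/-- One SGDA update from `x`, with noise field `u`. -/
def sgdaStep {d : ℕ} (V : Vec d → Vec d) (γ : ℝ) (u : Vec d → Vec d) (x : Vec d) : Vec d :=
  x - γ • (V x + u x)

/-- One (double step-size) SEG update from `x`, with noise field `u` for the look-ahead step and
`u'` for the update step. -/
def segStep {d : ℕ} (V : Vec d → Vec d) (α γ : ℝ) (u u' : Vec d → Vec d) (x : Vec d) : Vec d :=
  let y := x - γ • (V x + u x)
  x - (α * γ) • (V y + u' y)

/-- The SGDA iterates started at `x₀`. -/
def sgda {d : ℕ} {Ω : Type*} (V : Vec d → Vec d) (γ : ℝ) (U : ℕ → Vec d → Ω → Vec d)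
    (x₀ : Vec d) : ℕ → Ω → Vec d
  | 0, _ => x₀
  | n + 1, ω => sgdaStep V γ (fun x => U n x ω) (sgda V γ U x₀ n ω)

/-- The SEG iterates started at `x₀`; `U n` and `U' n` are the noises at times `n`, `n + 1/2`. -/
def seg {d : ℕ} {Ω : Type*} (V : Vec d → Vec d) (α γ : ℝ) (U U' : ℕ → Vec d → Ω → Vec d)
    (x₀ : Vec d) : ℕ → Ω → Vec d
  | 0, _ => x₀
  | n + 1, ω => segStep V α γ (fun x => U n x ω) (fun x => U' n x ω) (seg V α γ U U' x₀ n ω)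

/-- The Markov kernel sending `x` to the law of the random update `F x` under `P`. -/
def updateKernel {d : ℕ} {Ω : Type*} [MeasurableSpace Ω] (P : Measure Ω)
    (F : Vec d → Ω → Vec d) : Kernel (Vec d) (Vec d) :=
  (Kernel.id ×ₖ Kernel.const (Vec d) P).map (fun q : Vec d × Ω => F q.1 q.2)

/-- The transition kernel of SGDA (by homogeneity in time, that of the first step). -/
def sgdaKernel {d : ℕ} {Ω : Type*} [MeasurableSpace Ω] (P : Measure Ω) (V : Vec d → Vec d) (γ : ℝ)
    (U : ℕ → Vec d → Ω → Vec d) : Kernel (Vec d) (Vec d) :=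
  updateKernel P fun x ω => sgdaStep V γ (fun y => U 0 y ω) x

/-- The transition kernel of SEG (by homogeneity in time, that of the first step). -/
def segKernel {d : ℕ} {Ω : Type*} [MeasurableSpace Ω] (P : Measure Ω) (V : Vec d → Vec d) (α γ : ℝ)
    (U U' : ℕ → Vec d → Ω → Vec d) : Kernel (Vec d) (Vec d) :=
  updateKernel P fun x ω => segStep V α γ (fun y => U 0 y ω) (fun y => U' 0 y ω) x

/-- Total variation distance of two probability measures. -/
def tvDist {d : ℕ} (ν π : Measure (Vec d)) : ℝ :=
  ⨆ A : {A : Set (Vec d) // MeasurableSet A}, |ν.real A - π.real A|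

/-- `π` is the unique stationary distribution of the chain with kernel `Q`, it has finite second
moment, and it is the geometric limit in law of the iterates `X x₀` from every `x₀`, both for
test functions of linear growth and in total variation. -/
structure IsGeometricLimit {d : ℕ} {Ω : Type*} [MeasurableSpace Ω] (P : Measure Ω)
    (Q : Kernel (Vec d) (Vec d)) (X : Vec d → ℕ → Ω → Vec d) (π : Measure (Vec d)) : Prop where
  prob : IsProbabilityMeasure π
  invariant : Q.Invariant π
  unique : ∀ π' : Measure (Vec d), IsProbabilityMeasure π' → Q.Invariant π' → π' = π
  second_moment : Integrable (fun x => ‖x‖ ^ 2) π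
  test_function : ∀ f : Vec d → ℝ, Measurable f →
    (∃ Gf : ℝ, 0 < Gf ∧ ∀ x, |f x| ≤ Gf * (1 + ‖x‖)) →
    Integrable f π ∧
    ∃ ρ : ℝ, 0 < ρ ∧ ρ < 1 ∧ ∀ x₀ : Vec d, ∃ c : ℝ, 0 < c ∧ ∀ n : ℕ,
      Integrable (fun ω => f (X x₀ n ω)) P ∧
      |(∫ ω, f (X x₀ n ω) ∂P) - ∫ x, f x ∂π| ≤ c * ρ ^ n
  total_variation : ∃ ρ : ℝ, 0 < ρ ∧ ρ < 1 ∧ ∀ x₀ : Vec d, ∃ c : ℝ, 0 < c ∧ ∀ n : ℕ,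
    tvDist (P.map (X x₀ n)) π ≤ c * ρ ^ n

/-- For Lipschitz test functions the stationary mean is within `Lf * √D` of the value at any
solution. -/
def LipschitzBias {d : ℕ} (V : Vec d → Vec d) (π : Measure (Vec d)) (D : ℝ) : Prop :=
  ∀ (f : Vec d → ℝ) (Lf : ℝ≥0), LipschitzWith Lf f → ∀ xs ∈ solutions V,
    |(∫ x, f x ∂π) - f xs| ≤ Lf * √D

end StochVI

end

open MeasureTheory ProbabilityTheory Filter Topology
open scoped ENNReal NNReal

/-! Both algorithms are Markov chains driven by i.i.d. random maps, and the proof is Harris' theorem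
with the Lyapunov function `W x = ‖x - xs‖ ^ 2`, where `xs` is the solution given by
quasi-monotonicity. Two facts are needed.

Drift: one step satisfies `E[W] ≤ κ W + b` with `κ < 1`. The zero mean of the noise removes the
cross terms, monotonicity supplies the contraction, and the step-size condition absorbs the
quadratic terms (`geometricDrift_sgda`, `geometricDrift_seg`).

Overlap: transition laws from any two points of a sublevel set of `W` share a mass `δ > 0`. The part
of the noise with a density fills most of a large ball, up to a positive factor, and bounded
translates of that ball still overlap. The other noise component, and for SEG also the look-ahead
point, is frozen at a typical bounded value (`PositiveDensityPart.exists_overlap`, `overlapOn_sgda`,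
`overlapOn_seg`).

Drift and overlap make the transition operator a strict contraction for an oscillation weighted by
`1 + β W` (`GeometricDrift.exists_contraction`). By duality the laws form a Cauchy sequence, whose
limit is the unique invariant law, with geometric convergence (`GeometricDrift.exists_invariant`).
The weight dominates both indicators and functions of linear growth, so one estimate gives total
variation and test functions.

For the bias, integrating the drift against `π` gives `∫ W ∂π ≤ b / (1 - κ)`. Every solution is
within `√(lam / μ)` of `xs`, so the mean distance from `π` to any solution is controlled
(`lipschitzBias_of_integral_sq_le`). -/

namespace StochVI

/-! ### Contraction of the weighted oscillation under drift and overlap. -/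

section Harris

variable {E : Type*}

/-- The weighted oscillation of `f` is at most `a`: up to an additive constant, `f` is bounded by
`a * (1 + β * W)`. -/
def WeightedOsc (W : E → ℝ) (β a : ℝ) (f : E → ℝ) : Prop :=
  ∃ c, ∀ x, |f x - c| ≤ a * (1 + β * W x)

/-- The pairwise bound says that every value of `f - a(1 + βW)` lies below every value of `f + a(1 +
βW)`, so the supremum of the former serves as the centring constant. Contraction then only has to be
checked on pairs of points. -/
theorem weightedOsc_of_forall_sub_le [Nonempty E] {W : E → ℝ} {β a : ℝ} {f : E → ℝ}
    (h : ∀ x y, f x - f y ≤ a * (2 + β * (W x + W y))) : WeightedOsc W β a f := by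
  have hle (x y : E) : f x - a * (1 + β * W x) ≤ f y + a * (1 + β * W y) := by
    linarith [h x y]
  refine ⟨⨆ x, (f x - a * (1 + β * W x)), fun x => abs_le.2 ⟨?_, ?_⟩⟩
  · have : ⨆ y, (f y - a * (1 + β * W y)) ≤ f x + a * (1 + β * W x) := ciSup_le fun y => hle y x
    linarith
  · have : f x - a * (1 + β * W x) ≤ ⨆ y, (f y - a * (1 + β * W y)) :=
      le_ciSup (f := fun y => f y - a * (1 + β * W y))
        ⟨f x + a * (1 + β * W x), by rintro _ ⟨y, rfl⟩; exact hle y x⟩ x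
    linarith

theorem weightedOsc_indicator {W : E → ℝ} (hW : ∀ x, 0 ≤ W x) {β : ℝ} (hβ : 0 ≤ β) (A : Set E) :
    WeightedOsc W β 1 (A.indicator 1) := by
  refine ⟨0, fun x => ?_⟩
  have := mul_nonneg hβ (hW x)
  by_cases hx : x ∈ A <;> simp [hx] <;> linarith

variable [MeasurableSpace E]

/-- If `ν` exceeds `ν'` by at most `η` on every event, the same holds, up to a factor `M`, for the
integrals of a function with values in `[0, M]`. -/
theorem integral_le_add_of_forall_measureReal_le {ν ν' : Measure E} [IsProbabilityMeasure ν]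
    [IsProbabilityMeasure ν'] {η M : ℝ} (hM : 0 ≤ M)
    (h : ∀ A, MeasurableSet A → ν.real A ≤ ν'.real A + η) {g : E → ℝ} (hg : Measurable g)
    (hg0 : ∀ x, 0 ≤ g x) (hgM : ∀ x, g x ≤ M) :
    ∫ x, g x ∂ν ≤ ∫ x, g x ∂ν' + M * η := by
  have hint (m : Measure E) [IsProbabilityMeasure m] : Integrable g m :=
    Integrable.of_bound hg.aestronglyMeasurable M
      (ae_of_all _ fun x => by rw [Real.norm_of_nonneg (hg0 x)]; exact hgM x)
  have hlevel (m : Measure E) [IsProbabilityMeasure m] :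
      IntegrableOn (fun t => m.real {a | t ≤ g a}) (Set.Ioc 0 M) := by
    refine Integrable.of_bound (C := 1) ?_ (ae_of_all _ fun t => ?_)
    · refine (Antitone.measurable fun s t hst => ?_).aestronglyMeasurable
      exact measureReal_mono fun a (ha : t ≤ g a) => hst.trans ha
    · rw [Real.norm_of_nonneg measureReal_nonneg]
      exact measureReal_le_one
  -- Layer cake: the integrals are over levels `t ∈ (0, M]` of the masses of `{t ≤ g}`, and each
  -- level loses at most `η`.
  rw [(hint ν).integral_eq_integral_Ioc_meas_le (ae_of_all _ hg0) (ae_of_all _ hgM),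
    (hint ν').integral_eq_integral_Ioc_meas_le (ae_of_all _ hg0) (ae_of_all _ hgM)]
  calc ∫ t in Set.Ioc 0 M, ν.real {a | t ≤ g a}
      ≤ ∫ t in Set.Ioc 0 M, (ν'.real {a | t ≤ g a} + η) := by
        refine integral_mono (hlevel ν) ((hlevel ν').add (integrable_const _)) fun t => ?_
        exact h _ (measurableSet_le measurable_const hg)
    _ = _ := by
        rw [integral_add (hlevel ν') (integrable_const _)]
        simp [hM]

theorem WeightedOsc.integrable {W : E → ℝ} {β a : ℝ} {f : E → ℝ} (h : WeightedOsc W β a f)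
    (hf : Measurable f) {ν : Measure E} [IsProbabilityMeasure ν] (hW : Integrable W ν) :
    Integrable f ν := by
  obtain ⟨c, hc⟩ := h
  refine Integrable.mono' (g := fun x => |c| + a * (1 + β * W x)) ?_ hf.aestronglyMeasurable
    (ae_of_all _ fun x => ?_)
  · exact (integrable_const _).add
      (((integrable_const (1 : ℝ)).add (hW.const_mul β)).const_mul a)
  · have := abs_add_le (f x - c) c
    rw [sub_add_cancel] at this
    rw [Real.norm_eq_abs]
    linarith [hc x]

theorem WeightedOsc.abs_integral_sub_integral_le {W : E → ℝ} {β a : ℝ} {f : E → ℝ}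
    (h : WeightedOsc W β a f) (hf : Measurable f) {ν ν' : Measure E} [IsProbabilityMeasure ν]
    [IsProbabilityMeasure ν'] (hW : Integrable W ν) (hW' : Integrable W ν') :
    |∫ x, f x ∂ν - ∫ x, f x ∂ν'| ≤ a * (2 + β * (∫ x, W x ∂ν + ∫ x, W x ∂ν')) := by
  obtain ⟨c, hc⟩ := id h
  have key (m : Measure E) [IsProbabilityMeasure m] (hm : Integrable W m) :
      |∫ x, f x ∂m - c| ≤ a * (1 + β * ∫ x, W x ∂m) := by
    have hfi := h.integrable hf hm
    have e1 : ∫ x, f x ∂m - c = ∫ x, (f x - c) ∂m := by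
      rw [integral_sub hfi (integrable_const _)]; simp
    have hb : Integrable (fun x => 1 + β * W x) m := (integrable_const _).add (hm.const_mul β)
    have e2 : a * (1 + β * ∫ x, W x ∂m) = ∫ x, a * (1 + β * W x) ∂m := by
      rw [integral_const_mul, integral_add (integrable_const _) (hm.const_mul β),
        integral_const_mul]
      simp
    rw [e1, e2]
    exact (abs_integral_le_integral_abs).trans (integral_mono
      (hfi.sub (integrable_const _)).abs (hb.const_mul a) hc)
  have h1 := abs_le.1 (key ν hW)
  have h2 := abs_le.1 (key ν' hW')
  rw [abs_le]
  constructor <;> linarith [h1.1, h1.2, h2.1, h2.2]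

/-- Foster–Lyapunov drift condition. -/
structure GeometricDrift (Q : Kernel E E) (W : E → ℝ) (κ b : ℝ) : Prop where
  measurable : Measurable W
  nonneg : ∀ x, 0 ≤ W x
  integrable : ∀ x, Integrable W (Q x)
  drift : ∀ x, ∫ y, W y ∂Q x ≤ κ * W x + b

/-- Any two of the measures `Q x`, `x ∈ S`, have at least the mass `δ` in common. -/
def OverlapOn (Q : Kernel E E) (S : Set E) (δ : ℝ) : Prop :=
  ∀ x ∈ S, ∀ y ∈ S, ∀ A, MeasurableSet A → δ ≤ (Q x).real A + (Q y).real Aᶜ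

variable {Q : Kernel E E} {W : E → ℝ} {κ b : ℝ}

theorem GeometricDrift.integrable_bind (h : GeometricDrift Q W κ b) {ν : Measure E}
    [IsProbabilityMeasure ν] (hW : Integrable W ν) : Integrable W (ν.bind Q) := by
  rw [Measure.integrable_comp_iff h.measurable.aestronglyMeasurable]
  refine ⟨ae_of_all _ h.integrable, ?_⟩
  refine Integrable.mono' ((hW.const_mul κ).add (integrable_const b))
    (h.measurable.norm.stronglyMeasurable.integral_kernel).aestronglyMeasurable
    (ae_of_all _ fun x => ?_)
  rw [Real.norm_of_nonneg (integral_nonneg fun _ => norm_nonneg _)]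
  simp only [Real.norm_of_nonneg (h.nonneg _)]
  exact h.drift x

theorem integral_bind_kernel {ν : Measure E} [IsProbabilityMeasure ν] {f : E → ℝ}
    (hf : Integrable f (ν.bind Q)) : ∫ y, f y ∂(ν.bind Q) = ∫ x, ∫ y, f y ∂Q x ∂ν := by
  have e : ν.bind Q = (Q ∘ₖ Kernel.const Unit ν) () := Measure.comp_eq_comp_const_apply
  rw [e] at hf ⊢
  rw [Kernel.integral_comp hf, Kernel.const_apply]

theorem GeometricDrift.integral_bind_le (h : GeometricDrift Q W κ b) {ν : Measure E}
    [IsProbabilityMeasure ν] (hW : Integrable W ν) :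
    ∫ y, W y ∂(ν.bind Q) ≤ κ * ∫ x, W x ∂ν + b := by
  have hb := h.integrable_bind hW
  rw [integral_bind_kernel hb]
  calc ∫ x, ∫ y, W y ∂Q x ∂ν ≤ ∫ x, (κ * W x + b) ∂ν := by
        refine integral_mono_of_nonneg (ae_of_all _ fun x => integral_nonneg h.nonneg)
          ((hW.const_mul κ).add (integrable_const b)) (ae_of_all _ h.drift)
    _ = _ := by
        rw [integral_add (hW.const_mul κ) (integrable_const b), integral_const_mul]
        simp

variable [IsMarkovKernel Q]

/-- Contraction of the transition operator on pairs of points with common mass. -/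
theorem sub_integral_le_of_overlap (h : GeometricDrift Q W κ b) {β δ c : ℝ} (hβ : 0 ≤ β)
    {f : E → ℝ} (hf : Measurable f) (hc : ∀ x, |f x - c| ≤ 1 + β * W x) {x y : E}
    (hxy : ∀ A, MeasurableSet A → δ ≤ (Q x).real A + (Q y).real Aᶜ) :
    ∫ z, f z ∂Q x - ∫ z, f z ∂Q y
      ≤ 2 * (1 - δ) + β * (κ * (W x + W y) + 2 * b) := by
  -- Split `f - c` into its truncation to `[-1, 1]`, controlled by the overlap, and a remainder of
  -- size at most `β W`, controlled by the drift.
  set f1 : E → ℝ := fun z => max (-1) (min 1 (f z - c)) with hf1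
  have hf1m : Measurable f1 := measurable_const.max (measurable_const.min (hf.sub_const c))
  have hf1b (z) : -1 ≤ f1 z ∧ f1 z ≤ 1 := by
    simp only [hf1]; refine ⟨le_max_left _ _, max_le (by norm_num) (min_le_left _ _)⟩
  have hf2 (z) : |f z - c - f1 z| ≤ β * W z := by
    have h0 : 0 ≤ β * W z := mul_nonneg hβ (h.nonneg z)
    have h1 := abs_le.1 (hc z)
    simp only [hf1]
    rw [abs_le]
    rcases le_total 1 (f z - c) with h2 | h2
    · rw [min_eq_left h2, max_eq_right (by norm_num)]
      constructor <;> linarith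
    · rw [min_eq_right h2]
      rcases le_total (-1) (f z - c) with h3 | h3
      · rw [max_eq_right h3]; constructor <;> linarith
      · rw [max_eq_left h3]; constructor <;> linarith
  have hi1 (w) : Integrable f1 (Q w) := Integrable.of_bound hf1m.aestronglyMeasurable 1
    (ae_of_all _ fun z => by rw [Real.norm_eq_abs, abs_le]; exact hf1b z)
  have hi2 (w) : Integrable (fun z => f z - c - f1 z) (Q w) :=
    Integrable.mono' ((h.integrable w).const_mul β)
      ((hf.sub_const c).sub hf1m).aestronglyMeasurable
      (ae_of_all _ fun z => by rw [Real.norm_eq_abs]; exact hf2 z)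
  have hsplit (w) : ∫ z, f z ∂Q w = c + ∫ z, f1 z ∂Q w + ∫ z, (f z - c - f1 z) ∂Q w := by
    have : (fun z => f z) = fun z => (c + f1 z) + (f z - c - f1 z) := by ext z; ring
    have hi3 : Integrable (fun z => c + f1 z) (Q w) := (integrable_const c).add (hi1 w)
    rw [this, integral_add hi3 (by simpa using hi2 w), integral_add (integrable_const c) (hi1 w)]
    simp
  have hb2 (w) : |∫ z, (f z - c - f1 z) ∂Q w| ≤ β * (κ * W w + b) := by
    calc |∫ z, (f z - c - f1 z) ∂Q w| ≤ ∫ z, |f z - c - f1 z| ∂Q w := abs_integral_le_integral_abs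
      _ ≤ ∫ z, β * W z ∂Q w := integral_mono (hi2 w).abs ((h.integrable w).const_mul β) hf2
      _ ≤ _ := by
        rw [integral_const_mul]
        exact mul_le_mul_of_nonneg_left (h.drift w) hβ
  have hTV : ∫ z, (f1 z + 1) ∂Q x ≤ ∫ z, (f1 z + 1) ∂Q y + 2 * (1 - δ) := by
    refine integral_le_add_of_forall_measureReal_le (by norm_num) (fun A hA => ?_)
      (hf1m.add_const 1) (fun z => by linarith [(hf1b z).1]) (fun z => by linarith [(hf1b z).2])
    have := hxy Aᶜ hA.compl
    rw [compl_compl, probReal_compl_eq_one_sub hA] at this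
    linarith
  rw [integral_add (hi1 x) (integrable_const _), integral_add (hi1 y) (integrable_const _)] at hTV
  simp only [integral_const, probReal_univ, smul_eq_mul, one_mul] at hTV
  rw [hsplit x, hsplit y]
  have hx := abs_le.1 (hb2 x)
  have hy := abs_le.1 (hb2 y)
  linarith [hx.2, hy.1]

/-- The transition operator contracts the weighted oscillation. -/
theorem GeometricDrift.exists_contraction [Nonempty E] (h : GeometricDrift Q W κ b) (hκ0 : 0 ≤ κ)
    (hκ1 : κ < 1) (hb : 0 < b) (hS : ∀ r, ∃ δ, 0 < δ ∧ OverlapOn Q {x | W x ≤ r} δ) :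
    ∃ β ρ : ℝ, 0 < β ∧ 0 < ρ ∧ ρ < 1 ∧ ∀ (a : ℝ) (f : E → ℝ), 0 < a → Measurable f →
      WeightedOsc W β a f → WeightedOsc W β (ρ * a) fun x => ∫ y, f y ∂Q x := by
  have hκ : 0 < 1 - κ := by linarith
  -- Beyond `r`, the term `2b` costs at most half of the drift gain `(1 - κ)(W x + W y)`.
  set r : ℝ := 4 * b / (1 - κ) with hr
  have hr0 : 0 < r := by positivity
  have hrb : 4 * b = (1 - κ) * r := by rw [hr]; field_simp
  obtain ⟨δ, hδ0, hδ⟩ := hS r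
  -- With this weight the drift constant `2βb` uses up only half of the overlap gain `2δ`.
  set β : ℝ := δ / (2 * b) with hβ
  have hβ0 : 0 < β := by positivity
  have hβb : 2 * (β * b) = δ := by rw [hβ]; field_simp
  set τ : ℝ := (1 + κ) / 2 with hτ
  have hden : 0 < 2 + β * r := by positivity
  set ρ₁ : ℝ := (2 + τ * (β * r)) / (2 + β * r) with hρ₁
  have hτ1 : τ < 1 := by rw [hτ]; linarith
  have hτ0 : 0 < τ := by rw [hτ]; linarith
  have hρ₁0 : 0 < ρ₁ := by positivity
  have hρ₁1 : ρ₁ < 1 := by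
    rw [hρ₁, div_lt_one hden]
    nlinarith [mul_pos hβ0 hr0]
  have hρ₁e : ρ₁ * (2 + β * r) = 2 + τ * (β * r) := by rw [hρ₁]; field_simp
  -- The rates `1 - δ/2` and `κ` serve pairs with `W x + W y ≤ r`; `ρ₁` serves the others, being the
  -- value at `s = r` of the decreasing ratio `(2 + τβs) / (2 + βs)`.
  set ρ : ℝ := max (1 - δ / 2) (max κ ρ₁) with hρ
  have h1ρ : 1 - δ / 2 ≤ ρ := le_max_left _ _
  have h2ρ : κ ≤ ρ := (le_max_left _ _).trans (le_max_right _ _)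
  have h3ρ : ρ₁ ≤ ρ := (le_max_right _ _).trans (le_max_right _ _)
  refine ⟨β, ρ, hβ0, hρ₁0.trans_le h3ρ, max_lt (by linarith) (max_lt hκ1 hρ₁1), ?_⟩
  intro a f ha hf hosc
  obtain ⟨c, hc⟩ := id hosc
  refine weightedOsc_of_forall_sub_le fun x y => ?_
  have hWx := h.nonneg x
  have hWy := h.nonneg y
  rcases le_or_gt (W x + W y) r with hle | hgt
  · have hc' (z : E) : |a⁻¹ * f z - a⁻¹ * c| ≤ 1 + β * W z := by
      rw [← mul_sub, abs_mul, abs_of_pos (inv_pos.2 ha), inv_mul_le_iff₀ ha]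
      exact hc z
    have := sub_integral_le_of_overlap h hβ0.le (hf.const_mul a⁻¹) hc'
      (hδ x (show W x ≤ r by linarith) y (show W y ≤ r by linarith))
    rw [integral_const_mul, integral_const_mul, ← mul_sub, inv_mul_le_iff₀ ha] at this
    refine this.trans ?_
    rw [mul_comm ρ a, mul_assoc]
    refine mul_le_mul_of_nonneg_left ?_ ha.le
    have h5 : κ * (β * (W x + W y)) ≤ ρ * (β * (W x + W y)) :=
      mul_le_mul_of_nonneg_right h2ρ (by positivity)
    nlinarith
  · have h4 := hosc.abs_integral_sub_integral_le hf (h.integrable x) (h.integrable y)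
    refine (le_abs_self _).trans (h4.trans ?_)
    rw [mul_comm ρ a, mul_assoc]
    refine mul_le_mul_of_nonneg_left ?_ ha.le
    have h5 : β * (∫ z, W z ∂Q x + ∫ z, W z ∂Q y) ≤ β * (κ * (W x + W y) + 2 * b) :=
      mul_le_mul_of_nonneg_left (by linarith [h.drift x, h.drift y]) hβ0.le
    have h6 : 2 * b ≤ (1 - κ) / 2 * (W x + W y) := by nlinarith
    have h7 : β * (κ * (W x + W y) + 2 * b) ≤ τ * (β * (W x + W y)) := by
      have := mul_le_mul_of_nonneg_left h6 hβ0.le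
      rw [hτ]; linarith
    have h8 : 2 + τ * (β * (W x + W y)) ≤ ρ₁ * (2 + β * (W x + W y)) := by
      have hτρ : τ ≤ ρ₁ := by
        rw [hρ₁, le_div_iff₀ hden]; linarith
      have : 0 ≤ (ρ₁ - τ) * (β * (W x + W y - r)) :=
        mul_nonneg (by linarith) (mul_nonneg hβ0.le (by linarith))
      linarith
    have h9 : ρ₁ * (2 + β * (W x + W y)) ≤ ρ * (2 + β * (W x + W y)) :=
      mul_le_mul_of_nonneg_right h3ρ (by positivity)
    linarith

end Harris

/-! ### Evolution of laws and Harris' theorem. -/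

section Evolution

variable {E : Type*} [MeasurableSpace E]

/-- A sequence of probability measures which is uniformly Cauchy on events has a limit. -/
theorem exists_limit_measure {ν : ℕ → Measure E} [∀ n, IsProbabilityMeasure (ν n)] {ε : ℕ → ℝ}
    (hε : Tendsto ε atTop (𝓝 0))
    (h : ∀ A, MeasurableSet A → ∀ n m, n ≤ m → |(ν n).real A - (ν m).real A| ≤ ε n) :
    ∃ π : Measure E, IsProbabilityMeasure π ∧
      ∀ A, MeasurableSet A → ∀ n, |(ν n).real A - π.real A| ≤ ε n := by
  classical
  have hlim (A : Set E) (hA : MeasurableSet A) : ∃ l, Tendsto (fun n => (ν n).real A) atTop (𝓝 l) := by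
    refine cauchySeq_tendsto_of_complete (cauchySeq_of_le_tendsto_0' ε (fun n m hnm => ?_) hε)
    rw [Real.dist_eq]
    exact h A hA n m hnm
  choose! m hm using hlim
  have hmε (A : Set E) (hA : MeasurableSet A) (n : ℕ) : |(ν n).real A - m A| ≤ ε n := by
    refine le_of_tendsto ((tendsto_const_nhds.sub (hm A hA)).abs) ?_
    filter_upwards [eventually_ge_atTop n] with k hk using h A hA n k hk
  have hm0 (A : Set E) (hA : MeasurableSet A) : 0 ≤ m A :=
    ge_of_tendsto' (hm A hA) fun n => measureReal_nonneg
  have hsum (A : ℕ → Set E) (hA : ∀ i, MeasurableSet (A i))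
      (hd : Pairwise (Function.onFun Disjoint A)) :
      HasSum (fun i => m (A i)) (m (⋃ i, A i)) := by
    have hfin (n : ℕ) (s : Finset ℕ) :
        ∑ i ∈ s, (ν n).real (A i) = (ν n).real (⋃ i ∈ s, A i) :=
      (measureReal_biUnion_finset (fun i _ j _ hij => hd hij) (fun i _ => hA i)).symm
    have hmfin (s : Finset ℕ) : ∑ i ∈ s, m (A i) = m (⋃ i ∈ s, A i) := by
      refine tendsto_nhds_unique (tendsto_finsetSum s fun i _ => hm _ (hA i)) ?_
      simp_rw [hfin]
      exact hm _ (s.measurableSet_biUnion fun i _ => hA i)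
    -- Countable additivity is an exchange of limits. Partial sums are masses of finite unions, so
    -- convergence in `n` is uniform over the finite sets `s`.
    refine TendstoUniformly.tendsto_of_eventually_tendsto (p := atTop)
      (F := fun n (s : Finset ℕ) => ∑ i ∈ s, (ν n).real (A i)) (L := fun n => (ν n).real (⋃ i, A i))
      ?_ (Eventually.of_forall fun n => ?_) (hm _ (MeasurableSet.iUnion hA))
    · rw [Metric.tendstoUniformly_iff]
      intro e he
      filter_upwards [hε.eventually (gt_mem_nhds he)] with n hn s
      rw [hfin, hmfin, dist_comm, Real.dist_eq]
      exact (hmε _ (s.measurableSet_biUnion fun i _ => hA i) n).trans_lt hn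
    · have := (ν n).toSignedMeasure.m_iUnion hA hd
      simpa only [HasSum, Measure.toSignedMeasure_apply_measurable (hA _),
        Measure.toSignedMeasure_apply_measurable (MeasurableSet.iUnion hA)] using this
  have hmE : m ∅ = 0 := tendsto_nhds_unique (hm ∅ MeasurableSet.empty) (by simp)
  let S : SignedMeasure E :=
    { measureOf' := fun A => if MeasurableSet A then m A else 0
      empty' := by simp [hmE]
      not_measurable' := fun A hA => by simp [hA]
      m_iUnion' := fun A hA hd => by
        simpa only [hA, MeasurableSet.iUnion hA, if_true] using hsum A hA hd }
  have hSA (A : Set E) (hA : MeasurableSet A) : S A = m A := if_pos hA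
  have hS : VectorMeasure.restrict 0 Set.univ ≤ VectorMeasure.restrict S Set.univ := by
    rw [VectorMeasure.restrict_le_restrict_iff _ _ MeasurableSet.univ]
    intro A hA _
    rw [hSA A hA]
    exact hm0 A hA
  have hreal (A : Set E) (hA : MeasurableSet A) :
      (S.toMeasureOfZeroLE Set.univ MeasurableSet.univ hS).real A = m A := by
    rw [SignedMeasure.toMeasureOfZeroLE_real_apply S hS MeasurableSet.univ hA, Set.univ_inter,
      hSA A hA]
  have huniv : m Set.univ = 1 :=
    tendsto_nhds_unique (hm _ MeasurableSet.univ) (by simp)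
  refine ⟨S.toMeasureOfZeroLE Set.univ MeasurableSet.univ hS, ⟨?_⟩, fun A hA n => ?_⟩
  · have := hreal _ MeasurableSet.univ
    rw [huniv, measureReal_def, ENNReal.toReal_eq_one_iff] at this
    exact this
  · rw [hreal A hA]
    exact hmε A hA n

/-- The law at time `n` of the Markov chain with transition kernel `Q` and initial law `ν`. -/
noncomputable def evolve (Q : Kernel E E) (ν : Measure E) : ℕ → Measure E
  | 0 => ν
  | n + 1 => (evolve Q ν n).bind Q

variable {Q : Kernel E E}

theorem evolve_add (ν : Measure E) (m n : ℕ) :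
    evolve Q (evolve Q ν m) n = evolve Q ν (m + n) := by
  induction n with
  | zero => rfl
  | succ n ih => rw [evolve, ih, ← Nat.add_assoc, evolve]

theorem evolve_of_invariant {π : Measure E} (h : Q.Invariant π) (n : ℕ) : evolve Q π n = π := by
  induction n with
  | zero => rfl
  | succ n ih => rw [evolve, ih, h.def]

theorem measurable_lintegral_evolve_dirac (n : ℕ) {f : E → ℝ≥0∞} (hf : Measurable f) :
    Measurable fun x => ∫⁻ y, f y ∂evolve Q (Measure.dirac x) n := by
  induction n generalizing f with
  | zero => simpa only [evolve, lintegral_dirac' _ hf] using hf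
  | succ n ih =>
    simp only [evolve, Measure.lintegral_bind Q.aemeasurable hf.aemeasurable]
    exact ih hf.lintegral_kernel

theorem lintegral_evolve (ν : Measure E) (n : ℕ) {f : E → ℝ≥0∞} (hf : Measurable f) :
    ∫⁻ y, f y ∂evolve Q ν n = ∫⁻ x, ∫⁻ y, f y ∂evolve Q (Measure.dirac x) n ∂ν := by
  induction n generalizing f with
  | zero => simp only [evolve, lintegral_dirac' _ hf]
  | succ n ih =>
    simp only [evolve, Measure.lintegral_bind Q.aemeasurable hf.aemeasurable]
    exact ih hf.lintegral_kernel

variable [IsMarkovKernel Q]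

instance isProbabilityMeasure_evolve (ν : Measure E) [IsProbabilityMeasure ν] (n : ℕ) :
    IsProbabilityMeasure (evolve Q ν n) := by
  induction n with
  | zero => rw [evolve]; infer_instance
  | succ n ih => rw [evolve]; infer_instance

theorem measureReal_bind_kernel (ν : Measure E) [IsProbabilityMeasure ν] {A : Set E}
    (hA : MeasurableSet A) : (ν.bind Q).real A = ∫ x, (Q x).real A ∂ν := by
  rw [measureReal_def, Measure.bind_apply hA Q.aemeasurable]
  exact (integral_toReal (Q.measurable_coe hA).aemeasurable
    (ae_of_all _ fun x => measure_lt_top _ _)).symm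

variable {W : E → ℝ} {κ b : ℝ}

theorem GeometricDrift.integrable_evolve (h : GeometricDrift Q W κ b) {ν : Measure E}
    [IsProbabilityMeasure ν] (hW : Integrable W ν) (n : ℕ) : Integrable W (evolve Q ν n) := by
  induction n with
  | zero => exact hW
  | succ n ih => exact h.integrable_bind ih

/-- `b / (1 - κ)` is the fixed point of `t ↦ κ t + b`, so the bound reproduces itself. -/
theorem GeometricDrift.integral_evolve_le (h : GeometricDrift Q W κ b) (hκ0 : 0 ≤ κ) (hκ1 : κ < 1)
    (hb : 0 ≤ b) {ν : Measure E} [IsProbabilityMeasure ν] (hW : Integrable W ν) (n : ℕ) :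
    ∫ x, W x ∂evolve Q ν n ≤ ∫ x, W x ∂ν + b / (1 - κ) := by
  have hκ : 0 < 1 - κ := by linarith
  have hW0 : 0 ≤ ∫ x, W x ∂ν := integral_nonneg h.nonneg
  have hbe : b / (1 - κ) * (1 - κ) = b := div_mul_cancel₀ _ hκ.ne'
  induction n with
  | zero => rw [evolve]; linarith [div_nonneg hb hκ.le]
  | succ n ih =>
    have h1 := h.integral_bind_le (h.integrable_evolve hW n)
    have h2 := mul_le_mul_of_nonneg_left ih hκ0
    rw [evolve]
    nlinarith

/-- Duality: each step of the law is moved onto the test function, where the operator contracts.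
Hence the induction varies `f` and `a`. -/
theorem abs_integral_evolve_sub_le (h : GeometricDrift Q W κ b) {β ρ : ℝ} (hρ : 0 < ρ)
    (hcontr : ∀ (a : ℝ) (f : E → ℝ), 0 < a → Measurable f →
      WeightedOsc W β a f → WeightedOsc W β (ρ * a) fun x => ∫ y, f y ∂Q x)
    {ν ν' : Measure E} [IsProbabilityMeasure ν] [IsProbabilityMeasure ν'] (hW : Integrable W ν)
    (hW' : Integrable W ν') (n : ℕ) {a : ℝ} {f : E → ℝ} (ha : 0 < a) (hf : Measurable f)
    (hosc : WeightedOsc W β a f) :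
    |∫ x, f x ∂evolve Q ν n - ∫ x, f x ∂evolve Q ν' n|
      ≤ ρ ^ n * (a * (2 + β * (∫ x, W x ∂ν + ∫ x, W x ∂ν'))) := by
  induction n generalizing a f with
  | zero => simpa [evolve] using hosc.abs_integral_sub_integral_le hf hW hW'
  | succ n ih =>
    have hi (m : Measure E) [IsProbabilityMeasure m] (hm : Integrable W m) :
        ∫ x, f x ∂evolve Q m (n + 1) = ∫ x, ∫ y, f y ∂Q x ∂evolve Q m n :=
      integral_bind_kernel (hosc.integrable hf (h.integrable_evolve hm (n + 1)))
    rw [hi ν hW, hi ν' hW']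
    refine (ih (mul_pos hρ ha) hf.stronglyMeasurable.integral_kernel.measurable
      (hcontr a f ha hf hosc)).trans_eq ?_
    ring

/-- Convergence on events passes only bounded functions to the limit, so the moment of the limit law
is reached through truncations. -/
theorem integrable_of_forall_integral_min_le {π : Measure E} [IsProbabilityMeasure π]
    (hWm : Measurable W) (hW : ∀ x, 0 ≤ W x) {B : ℝ}
    (h : ∀ M : ℕ, ∫ x, min (W x) M ∂π ≤ B) : Integrable W π := by
  refine ⟨hWm.aestronglyMeasurable, ?_⟩
  rw [hasFiniteIntegral_iff_ofReal (ae_of_all _ hW)]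
  have hsup (x : E) : ENNReal.ofReal (W x) = ⨆ M : ℕ, ENNReal.ofReal (min (W x) M) := by
    refine le_antisymm ?_ (iSup_le fun M => ENNReal.ofReal_le_ofReal (min_le_left _ _))
    refine le_iSup_of_le ⌈W x⌉₊ ?_
    rw [min_eq_left (Nat.le_ceil _)]
  simp_rw [hsup]
  rw [lintegral_iSup (fun M => (hWm.min measurable_const).ennreal_ofReal)]
  · refine lt_of_le_of_lt (iSup_le fun M => ?_) (ENNReal.ofReal_lt_top (r := B))
    have h0 (x : E) : 0 ≤ min (W x) (M : ℝ) := le_min (hW x) M.cast_nonneg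
    rw [← ofReal_integral_eq_lintegral_ofReal _ (ae_of_all _ h0)]
    · exact ENNReal.ofReal_le_ofReal (h M)
    · refine Integrable.of_bound (hWm.min measurable_const).aestronglyMeasurable M
        (ae_of_all _ fun x => ?_)
      rw [Real.norm_of_nonneg (h0 x)]
      exact min_le_right _ _
  · intro M N hMN x
    exact ENNReal.ofReal_le_ofReal (min_le_min_left _ (Nat.cast_le.2 hMN))

/-- `π'` may have no `W`-moment, so the contraction does not apply to it directly. Instead `π'` is a
mixture of the laws started at points, and dominated convergence applies. -/
theorem eq_of_invariant_of_tendsto {π π' : Measure E} [IsProbabilityMeasure π]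
    [IsProbabilityMeasure π'] (hπ' : Q.Invariant π')
    (h : ∀ A, MeasurableSet A → ∀ x,
      Tendsto (fun n => (evolve Q (Measure.dirac x) n).real A) atTop (𝓝 (π.real A))) :
    π' = π := by
  ext A hA
  have hind : Measurable (A.indicator (1 : E → ℝ≥0∞)) := measurable_one.indicator hA
  have hmeas (n : ℕ) : Measurable fun x => evolve Q (Measure.dirac x) n A := by
    simpa only [lintegral_indicator_one hA] using measurable_lintegral_evolve_dirac (Q := Q) n hind
  have hconst (n : ℕ) : ∫⁻ x, evolve Q (Measure.dirac x) n A ∂π' = π' A := by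
    have := lintegral_evolve (Q := Q) π' n hind
    simpa only [lintegral_indicator_one hA, evolve_of_invariant hπ'] using this.symm
  have hlim : Tendsto (fun n => ∫⁻ x, evolve Q (Measure.dirac x) n A ∂π') atTop
      (𝓝 (∫⁻ _, π A ∂π')) := by
    refine tendsto_lintegral_of_dominated_convergence (fun _ => 1) hmeas
      (fun n => ae_of_all _ fun x => prob_le_one) (by simp) (ae_of_all _ fun x => ?_)
    exact (ENNReal.tendsto_toReal_iff (fun n => measure_ne_top _ _) (measure_ne_top _ _)).1 (h A hA x)
  simp only [hconst, lintegral_const, measure_univ, mul_one] at hlim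
  exact tendsto_nhds_unique tendsto_const_nhds hlim

/-- **Harris' theorem**: a geometric drift towards sublevel sets on which the transition
probabilities overlap gives a unique invariant law, and geometric convergence to it. -/
theorem GeometricDrift.exists_invariant [Nonempty E] (h : GeometricDrift Q W κ b) (hκ0 : 0 ≤ κ)
    (hκ1 : κ < 1) (hb : 0 < b) (hS : ∀ r, ∃ δ, 0 < δ ∧ OverlapOn Q {x | W x ≤ r} δ) :
    ∃ π : Measure E, IsProbabilityMeasure π ∧ Q.Invariant π ∧ Integrable W π ∧
      (∀ π' : Measure E, IsProbabilityMeasure π' → Q.Invariant π' → π' = π) ∧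
      ∃ β ρ : ℝ, 0 < β ∧ 0 < ρ ∧ ρ < 1 ∧ ∀ (a : ℝ) (f : E → ℝ), 0 < a → Measurable f →
        WeightedOsc W β a f → ∀ (x : E) (n : ℕ),
        |∫ y, f y ∂evolve Q (Measure.dirac x) n - ∫ y, f y ∂π|
          ≤ ρ ^ n * (a * (2 + β * (W x + ∫ y, W y ∂π))) := by
  obtain ⟨β, ρ, hβ, hρ0, hρ1, hcontr⟩ := h.exists_contraction hκ0 hκ1 hb hS
  have hpow (C : ℝ) : Tendsto (fun n : ℕ => ρ ^ n * C) atTop (𝓝 0) := by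
    simpa using (tendsto_pow_atTop_nhds_zero_of_lt_one hρ0.le hρ1).mul_const C
  have hdirac (x : E) : Integrable W (Measure.dirac x) :=
    integrable_dirac' h.measurable.stronglyMeasurable (by simp)
  have hWdirac (x : E) : ∫ y, W y ∂Measure.dirac x = W x :=
    integral_dirac' _ _ h.measurable.stronglyMeasurable
  have hreal (m : Measure E) {A : Set E} (hA : MeasurableSet A) :
      ∫ y, A.indicator (1 : E → ℝ) y ∂m = m.real A := integral_indicator_one hA
  obtain ⟨x₀⟩ := ‹Nonempty E›
  set B : ℝ := W x₀ + b / (1 - κ) with hB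
  have hνB (n : ℕ) : ∫ y, W y ∂evolve Q (Measure.dirac x₀) n ≤ B := by
    have := h.integral_evolve_le hκ0 hκ1 hb.le (hdirac x₀) n
    rwa [hWdirac] at this
  set ε : ℕ → ℝ := fun n => ρ ^ n * (1 * (2 + β * (W x₀ + B))) with hεdef
  have hε : Tendsto ε atTop (𝓝 0) := hpow _
  obtain ⟨π, hπ, hlim⟩ := exists_limit_measure (ν := evolve Q (Measure.dirac x₀)) hε (by
    -- The law at time `k + n` is the law at time `n` started from the law at time `k`, whose
    -- `W`-moment is bounded uniformly in `k`.
    intro A hA n m hnm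
    obtain ⟨k, rfl⟩ := Nat.exists_eq_add_of_le hnm
    have := abs_integral_evolve_sub_le h hρ0 hcontr (hdirac x₀)
      (h.integrable_evolve (hdirac x₀) k) n one_pos (measurable_one.indicator hA)
      (weightedOsc_indicator h.nonneg hβ.le A)
    rw [hreal _ hA, hreal _ hA, evolve_add, hWdirac, add_comm k n] at this
    refine this.trans ?_
    have := hνB k
    simp only [hεdef]
    gcongr)
  have hinv : Q.Invariant π := by
    have : IsProbabilityMeasure (π.bind Q) := inferInstance
    refine Measure.ext fun A hA => ?_
    rw [← measureReal_eq_measureReal_iff]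
    have hg0 (x : E) : 0 ≤ (Q x).real A := measureReal_nonneg
    have hg1 (x : E) : (Q x).real A ≤ 1 := measureReal_le_one
    have hgm : Measurable fun x => (Q x).real A := (Q.measurable_coe hA).ennreal_toReal
    -- One step of `Q` cannot enlarge the distance between `π` and the law at time `n`, and the law
    -- at time `n + 1` is itself close to `π`.
    have hle (n : ℕ) : |(π.bind Q).real A - π.real A| ≤ ε n + ε (n + 1) := by
      have h1 := abs_le.1 (hlim A hA (n + 1))
      rw [evolve, measureReal_bind_kernel _ hA] at h1
      have h2 := integral_le_add_of_forall_measureReal_le (ν := evolve Q (Measure.dirac x₀) n)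
        (ν' := π) (η := ε n) zero_le_one
        (fun A hA => by linarith [(abs_le.1 (hlim A hA n)).2]) hgm hg0 hg1
      have h3 := integral_le_add_of_forall_measureReal_le (ν' := evolve Q (Measure.dirac x₀) n)
        (ν := π) (η := ε n) zero_le_one
        (fun A hA => by linarith [(abs_le.1 (hlim A hA n)).1]) hgm hg0 hg1
      rw [measureReal_bind_kernel _ hA, abs_le]
      constructor <;> linarith [h1.1, h1.2]
    have h0 := ge_of_tendsto' (hε.add (hε.comp (tendsto_add_atTop_nat 1))) hle
    rw [add_zero] at h0
    linarith [abs_le.1 h0, (abs_nonpos_iff.1 h0)]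
  have hWπ : Integrable W π := by
    refine integrable_of_forall_integral_min_le h.measurable h.nonneg (B := B) fun M => ?_
    have hle (n : ℕ) : ∫ x, min (W x) M ∂π ≤ B + M * ε n := by
      have h1 := integral_le_add_of_forall_measureReal_le (ν' := evolve Q (Measure.dirac x₀) n)
        (ν := π) (η := ε n) M.cast_nonneg
        (fun A hA => by linarith [(abs_le.1 (hlim A hA n)).1]) (h.measurable.min measurable_const)
        (fun x => le_min (h.nonneg x) M.cast_nonneg) (fun x => min_le_right _ _)
      have h2 : ∫ x, min (W x) M ∂evolve Q (Measure.dirac x₀) n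
          ≤ ∫ x, W x ∂evolve Q (Measure.dirac x₀) n :=
        integral_mono_of_nonneg (ae_of_all _ fun x => le_min (h.nonneg x) M.cast_nonneg)
          (h.integrable_evolve (hdirac x₀) n) (ae_of_all _ fun x => min_le_left _ _)
      linarith [hνB n]
    have := ge_of_tendsto' ((hε.const_mul (M : ℝ)).const_add B) hle
    simpa using this
  have hconv (a : ℝ) (f : E → ℝ) (ha : 0 < a) (hf : Measurable f) (hosc : WeightedOsc W β a f)
      (x : E) (n : ℕ) : |∫ y, f y ∂evolve Q (Measure.dirac x) n - ∫ y, f y ∂π|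
        ≤ ρ ^ n * (a * (2 + β * (W x + ∫ y, W y ∂π))) := by
    have := abs_integral_evolve_sub_le h hρ0 hcontr (hdirac x) hWπ n ha hf hosc
    rwa [evolve_of_invariant hinv, hWdirac] at this
  refine ⟨π, hπ, hinv, hWπ, fun π' _ hπ' => eq_of_invariant_of_tendsto hπ' fun A hA x => ?_,
    β, ρ, hβ, hρ0, hρ1, hconv⟩
  rw [tendsto_iff_dist_tendsto_zero]
  refine squeeze_zero (fun _ => dist_nonneg) (fun n => ?_) (hpow (1 * (2 + β * (W x + ∫ y, W y ∂π))))
  have := hconv 1 _ one_pos (measurable_one.indicator hA)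
    (weightedOsc_indicator h.nonneg hβ.le A) x n
  rwa [hreal _ hA, hreal _ hA] at this

end Evolution

/-! ### Random fields evaluated at independent random points. -/

section Decoupling

variable {Ω E : Type*} {m₁ m₂ : MeasurableSpace Ω} [mΩ : MeasurableSpace Ω] [mE : MeasurableSpace E] {P : Measure Ω}
  [IsProbabilityMeasure P]

theorem lintegral_indepFun_eq {Ω' : Type*} [MeasurableSpace Ω'] {Z : Ω → E} {T : Ω → Ω'}
    (hZ : Measurable Z) (hT : Measurable T) (hind : IndepFun Z T P) {g : E × Ω' → ℝ≥0∞}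
    (hg : Measurable g) :
    ∫⁻ ω, g (Z ω, T ω) ∂P = ∫⁻ ω', ∫⁻ ω, g (Z ω', T ω) ∂P ∂P := by
  have hpT : IsProbabilityMeasure (P.map T) := Measure.isProbabilityMeasure_map hT.aemeasurable
  rw [← lintegral_map hg (hZ.prodMk hT),
    (indepFun_iff_map_prod_eq_prod_map_map hZ.aemeasurable hT.aemeasurable).1 hind,
    lintegral_prod _ hg.aemeasurable, lintegral_map hg.lintegral_prod_right' hZ]
  refine lintegral_congr fun ω' => ?_
  exact lintegral_map (hg.comp measurable_prodMk_left) hT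

theorem measurable_prod_mono {F : Type*} [MeasurableSpace F] (h₂ : m₂ ≤ mΩ)
    {g : E × Ω → F} (hg : Measurable[MeasurableSpace.prod mE m₂] g) : Measurable g :=
  hg.mono (sup_le_sup le_rfl (MeasurableSpace.comap_mono h₂)) le_rfl

/-- Evaluating a random field at an independent random point amounts to averaging over independent
copies of the point and of the field. -/
theorem lintegral_decouple (h₁ : m₁ ≤ mΩ) (h₂ : m₂ ≤ mΩ) (hind : Indep m₁ m₂ P) {Z : Ω → E}
    (hZ : Measurable[m₁] Z) {g : E × Ω → ℝ≥0∞}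
    (hg : Measurable[MeasurableSpace.prod mE m₂] g) :
    ∫⁻ ω, g (Z ω, ω) ∂P = ∫⁻ ω', ∫⁻ ω, g (Z ω', ω) ∂P ∂P := by
  -- The field is carried by the identity map into `(Ω, m₂)`, a random element independent of `Z`;
  -- Fubini then applies.
  refine @lintegral_indepFun_eq Ω E mΩ mE P _ Ω m₂ Z id (hZ.mono h₁ le_rfl)
    (measurable_id.mono h₂ le_rfl) ?_ g hg
  have h : Indep (MeasurableSpace.comap Z mE) (MeasurableSpace.comap id m₂) P := by
    rw [MeasurableSpace.comap_id]
    exact indep_of_indep_of_le_left hind hZ.comap_le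
  exact h

theorem measure_decouple (h₁ : m₁ ≤ mΩ) (h₂ : m₂ ≤ mΩ) (hind : Indep m₁ m₂ P) {Z : Ω → E}
    (hZ : Measurable[m₁] Z) {D : Set (E × Ω)}
    (hD : MeasurableSet[MeasurableSpace.prod mE m₂] D) :
    P {ω | (Z ω, ω) ∈ D} = ∫⁻ ω', P {ω | (Z ω', ω) ∈ D} ∂P := by
  have hD' : MeasurableSet D :=
    sup_le_sup le_rfl (MeasurableSpace.comap_mono h₂) D hD
  have hZ' : Measurable Z := hZ.mono h₁ le_rfl
  have hg : Measurable[MeasurableSpace.prod mE m₂] (D.indicator (1 : E × Ω → ℝ≥0∞)) :=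
    Measurable.indicator measurable_const hD
  have h := lintegral_decouple h₁ h₂ hind hZ hg
  have e1 : ∫⁻ ω, D.indicator (1 : E × Ω → ℝ≥0∞) (Z ω, ω) ∂P = P {ω | (Z ω, ω) ∈ D} :=
    lintegral_indicator_one (μ := P) (s := {ω | (Z ω, ω) ∈ D})
      ((hZ'.prodMk measurable_id) hD')
  have e2 (ω' : Ω) : ∫⁻ ω, D.indicator (1 : E × Ω → ℝ≥0∞) (Z ω', ω) ∂P = P {ω | (Z ω', ω) ∈ D} :=
    lintegral_indicator_one (μ := P) (s := {ω | (Z ω', ω) ∈ D}) (measurable_prodMk_left hD')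
  simpa only [e1, e2] using h

/-- A nonnegative function takes on `s` some value at most its mean over `s`, hence at most twice
its full mean. This freezes an independent random point at a typical value, at the price of a factor
2. -/
theorem exists_measureReal_le_two_mul (h₁ : m₁ ≤ mΩ) (h₂ : m₂ ≤ mΩ) (hind : Indep m₁ m₂ P)
    {Z : Ω → E} (hZ : Measurable[m₁] Z) {D : Set (E × Ω)}
    (hD : MeasurableSet[MeasurableSpace.prod mE m₂] D) {s : Set Ω} (hs : 1 / 2 ≤ P.real s) :
    ∃ ω' ∈ s, P.real {ω | (Z ω', ω) ∈ D} ≤ 2 * P.real {ω | (Z ω, ω) ∈ D} := by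
  have hD' : MeasurableSet D :=
    sup_le_sup le_rfl (MeasurableSpace.comap_mono h₂) D hD
  have hZ' : Measurable Z := hZ.mono h₁ le_rfl
  have hm : Measurable fun ω' => P {ω | (Z ω', ω) ∈ D} :=
    (measurable_measure_prodMk_left hD').comp hZ'
  set g : Ω → ℝ := fun ω' => P.real {ω | (Z ω', ω) ∈ D} with hg
  have hg0 (ω) : 0 ≤ g ω := measureReal_nonneg
  have hgi : Integrable g P := Integrable.of_bound hm.ennreal_toReal.aestronglyMeasurable 1
    (ae_of_all _ fun ω => by rw [Real.norm_of_nonneg (hg0 ω)]; exact measureReal_le_one)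
  have hint : ∫ ω, g ω ∂P = P.real {ω | (Z ω, ω) ∈ D} := by
    rw [measureReal_def, measure_decouple h₁ h₂ hind hZ hD]
    exact integral_toReal hm.aemeasurable (ae_of_all _ fun ω => measure_lt_top _ _)
  have hs0 : 0 < P.real s := by linarith
  obtain ⟨ω', hω', hle⟩ := exists_le_setAverage (μ := P) (s := s) (f := g)
    (fun h => by simp [measureReal_def, h] at hs0) (measure_ne_top _ _) hgi.integrableOn
  refine ⟨ω', hω', hle.trans ?_⟩
  rw [setAverage_eq, smul_eq_mul, inv_mul_le_iff₀ hs0, ← hint]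
  have h1 : ∫ ω in s, g ω ∂P ≤ ∫ ω, g ω ∂P := setIntegral_le_integral hgi (ae_of_all _ hg0)
  have h2 : 0 ≤ ∫ ω, g ω ∂P := integral_nonneg hg0
  nlinarith

end Decoupling

/-! ### Common mass of the noise laws. -/

section Overlap

variable {d : ℕ} {Ω : Type*} [mΩ : MeasurableSpace Ω] {P : Measure Ω} [IsProbabilityMeasure P]

/-- The volume ratio is `(1 + M / r) ^ d`, which tends to 1 as `r` grows. -/
theorem exists_ball_ratio (d : ℕ) {M : ℝ} (hM : 0 ≤ M) :
    ∃ r : ℝ, 0 < r ∧ volume.real (Metric.ball (0 : Vec d) (r + M))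
      ≤ 5 / 4 * volume.real (Metric.ball (0 : Vec d) r) := by
  have hlim : Tendsto (fun r : ℝ => (1 + M / r) ^ d) atTop (𝓝 ((1 + 0) ^ d)) :=
    ((tendsto_const_nhds.div_atTop tendsto_id).const_add 1).pow d
  rw [add_zero, one_pow] at hlim
  obtain ⟨r, hr, hr0⟩ := ((hlim.eventually (gt_mem_nhds (show (1 : ℝ) < 5 / 4 by norm_num))).and
    (eventually_gt_atTop 0)).exists
  refine ⟨r, hr0, ?_⟩
  have hrM : 0 < r + M := by linarith
  have hvol (s : ℝ) (hs : 0 < s) : volume.real (Metric.ball (0 : Vec d) s)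
      = s ^ d * volume.real (Metric.ball (0 : Vec d) 1) := by
    rw [measureReal_def, Measure.addHaar_ball_of_pos _ _ hs, ENNReal.toReal_mul,
      ENNReal.toReal_ofReal (by positivity), finrank_euclideanSpace_fin, measureReal_def]
  rw [hvol r hr0, hvol _ hrM, ← mul_assoc]
  refine mul_le_mul_of_nonneg_right ?_ measureReal_nonneg
  have : r + M = (1 + M / r) * r := by field_simp
  rw [this, mul_pow]
  exact mul_le_mul_of_nonneg_right hr.le (by positivity)

/-- The lower bound on the densities is uniform in `x` but not in `t`. The sets of `t` where it
exceeds `1 / (n + 1)` increase to the ball, so one of them has volume above the fraction `θ`.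
Continuity from below needs no measurability of these sets, which are cut out by a possibly
uncountable infimum. -/
theorem exists_uniform_density_bound {p : Vec d → Vec d → ℝ≥0∞} {C : Set (Vec d)}
    (hp : ∀ t, 0 < ⨅ x ∈ C, p x t) {r θ : ℝ} (hr : 0 < r) (hθ : θ < 1) :
    ∃ ε : ℝ, 0 < ε ∧ ∀ x ∈ C, θ * volume.real (Metric.ball (0 : Vec d) r)
      ≤ volume.real {t ∈ Metric.ball (0 : Vec d) r | ENNReal.ofReal ε ≤ p x t} := by
  set B := Metric.ball (0 : Vec d) r
  let ε : ℕ → ℝ := fun n => ((n : ℝ) + 1)⁻¹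
  have hε0 (n : ℕ) : 0 < ε n := by positivity
  let S : ℕ → Set (Vec d) := fun n => {t ∈ B | ∀ x ∈ C, ENNReal.ofReal (ε n) ≤ p x t}
  have hmono : Monotone S := fun n m hnm t ht => ⟨ht.1, fun x hx => le_trans
    (ENNReal.ofReal_le_ofReal (by simp only [ε]; gcongr)) (ht.2 x hx)⟩
  have hU : ⋃ n, S n = B := by
    refine Set.Subset.antisymm (Set.iUnion_subset fun n t ht => ht.1) fun t ht => ?_
    obtain ⟨n, hn⟩ := ENNReal.exists_inv_nat_lt (hp t).ne'
    refine Set.mem_iUnion.2 ⟨n, ht, fun x hx => ?_⟩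
    refine le_trans ?_ (hn.le.trans (iInf₂_le x hx))
    rw [ENNReal.ofReal_inv_of_pos (by positivity)]
    refine ENNReal.inv_le_inv.2 ?_
    rw [ENNReal.ofReal_add (by positivity) zero_le_one, ENNReal.ofReal_natCast]
    exact le_self_add
  have hBtop : volume B ≠ ∞ := measure_ball_lt_top.ne
  have hB0 : 0 < volume.real B :=
    ENNReal.toReal_pos (Metric.measure_ball_pos _ _ hr).ne' hBtop
  have hlt : ENNReal.ofReal (θ * volume.real B) < ⨆ n, volume (S n) := by
    rw [← hmono.measure_iUnion, hU, ← ENNReal.ofReal_toReal hBtop]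
    exact (ENNReal.ofReal_lt_ofReal_iff hB0).2 (by nlinarith)
  obtain ⟨n, hn⟩ := lt_iSup_iff.1 hlt
  refine ⟨ε n, hε0 n, fun x hx => ?_⟩
  refine (ENNReal.ofReal_le_iff_le_toReal
    (ne_top_of_le_ne_top hBtop (measure_mono fun t ht => ht.1))).1 (hn.le.trans ?_)
  exact measure_mono fun t ht => ⟨ht.1, ht.2 x hx⟩

theorem mul_measureReal_le_map {X : Ω → Vec d} (hX : Measurable X) {q : Vec d → ℝ≥0∞}
    (hq : Measurable q) (h : P.map X = volume.withDensity q) {B : Set (Vec d)} {ε : ℝ}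
    (hε : 0 ≤ ε) {A : Set (Vec d)} (hA : MeasurableSet A) :
    ε * volume.real {t ∈ {t ∈ B | ENNReal.ofReal ε ≤ q t} | t ∈ A} ≤ P.real {ω | X ω ∈ A} := by
  have h1 : P {ω | X ω ∈ A} = ∫⁻ t in A, q t := by
    rw [← withDensity_apply _ hA, ← h, Measure.map_apply hX hA]; rfl
  have hle : ENNReal.ofReal ε * volume {t ∈ {t ∈ B | ENNReal.ofReal ε ≤ q t} | t ∈ A}
      ≤ P {ω | X ω ∈ A} := by
    have hS : MeasurableSet {t | ENNReal.ofReal ε ≤ q t} := measurableSet_le measurable_const hq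
    calc _ ≤ ENNReal.ofReal ε * volume ({t | ENNReal.ofReal ε ≤ q t} ∩ A) := by
          gcongr; exact fun t ht => ⟨ht.1.2, ht.2⟩
      _ = ∫⁻ t in {t | ENNReal.ofReal ε ≤ q t} ∩ A, ENNReal.ofReal ε := by simp
      _ ≤ ∫⁻ t in {t | ENNReal.ofReal ε ≤ q t} ∩ A, q t :=
          setLIntegral_mono hq fun t ht => ht.1
      _ ≤ ∫⁻ t in A, q t := lintegral_mono_set Set.inter_subset_right
      _ = _ := h1.symm
  have := ENNReal.toReal_mono (measure_ne_top P _) hle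
  rwa [ENNReal.toReal_mul, ENNReal.toReal_ofReal hε] at this

/-- Two sets filling most of a ball still meet after bounded translations. -/
theorem le_measureReal_translate_add {r M c : ℝ} {S S' : Set (Vec d)} (hSr : S ⊆ Metric.ball 0 r)
    (hSr' : S' ⊆ Metric.ball 0 r) (hc : c ≤ volume.real S) (hc' : c ≤ volume.real S')
    {v w : Vec d} (hv : ‖v‖ ≤ M) (hw : ‖w‖ ≤ M) {A : Set (Vec d)} (hA : MeasurableSet A) :
    2 * c - volume.real (Metric.ball (0 : Vec d) (r + M))
      ≤ volume.real {t ∈ S | t + v ∈ A} + volume.real {t ∈ S' | t + w ∈ Aᶜ} := by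
  set B := Metric.ball (0 : Vec d) (r + M)
  have hBtop : volume B ≠ ∞ := measure_ball_lt_top.ne
  have htrans (T : Set (Vec d)) (v : Vec d) :
      volume.real ((fun t => t + -v) ⁻¹' T) = volume.real T := by
    rw [measureReal_def, measure_preimage_add_right, measureReal_def]
  have hset (T A : Set (Vec d)) (v : Vec d) :
      (fun t => t + -v) ⁻¹' {t ∈ T | t + v ∈ A} = ((fun t => t + -v) ⁻¹' T) ∩ A := by
    ext t; simp
  have hsub (T : Set (Vec d)) (v : Vec d) (hT : T ⊆ Metric.ball 0 r) (hv : ‖v‖ ≤ M) :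
      (fun t => t + -v) ⁻¹' T ⊆ B := by
    intro t ht
    have h1 : ‖t + -v‖ < r := by simpa using hT ht
    rw [mem_ball_zero_iff]
    have h2 := norm_add_le (t + -v) v
    rw [neg_add_cancel_right] at h2
    linarith
  rw [← htrans {t ∈ S | t + v ∈ A} v, ← htrans {t ∈ S' | t + w ∈ Aᶜ} w, hset, hset]
  rw [← htrans S v] at hc
  rw [← htrans S' w] at hc'
  have hB1 := hsub S v hSr hv
  have hB2 := hsub S' w hSr' hw
  set S₁ := (fun t => t + -v) ⁻¹' S
  set S₂ := (fun t => t + -w) ⁻¹' S'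
  have e1 := measureReal_inter_add_sdiff (μ := volume) (s := S₁) hA
    (measure_ne_top_of_subset hB1 hBtop)
  have e2 := measureReal_inter_add_sdiff (μ := volume) (s := S₂) hA
    (measure_ne_top_of_subset hB2 hBtop)
  have e3 := measureReal_inter_add_sdiff (μ := volume) (s := B) hA hBtop
  have i1 : volume.real (S₁ \ A) ≤ volume.real (B \ A) :=
    measureReal_mono (Set.sdiff_subset_sdiff_left hB1)
      (measure_ne_top_of_subset Set.sdiff_subset hBtop)
  have i2 : volume.real (S₂ ∩ A) ≤ volume.real (B ∩ A) :=
    measureReal_mono (Set.inter_subset_inter_left A hB2)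
      (measure_ne_top_of_subset Set.inter_subset_left hBtop)
  rw [Set.sdiff_eq] at e2
  linarith

theorem measureReal_lt_norm_le_div_sq {X : Ω → Vec d} (hX : MemLp X 2 P) {σ : ℝ}
    (hσ : ∫ ω, ‖X ω‖ ^ 2 ∂P ≤ σ ^ 2) {M : ℝ} (hM : 0 < M) :
    P.real {ω | M < ‖X ω‖} ≤ σ ^ 2 / M ^ 2 := by
  rw [le_div_iff₀ (by positivity), mul_comm]
  have h := mul_meas_ge_le_integral_of_nonneg (μ := P) (f := fun ω => ‖X ω‖ ^ 2)
    (ae_of_all _ fun ω => by positivity) ((memLp_two_iff_integrable_sq_norm hX.1).1 hX) (M ^ 2)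
  refine le_trans (mul_le_mul_of_nonneg_left (measureReal_mono fun ω (hω : M < ‖X ω‖) => ?_)
    (by positivity)) (h.trans hσ)
  exact pow_le_pow_left₀ hM.le hω.le 2

/-- The laws of a noise field at any two points of a bounded set, translated by bounded vectors,
have a common mass which is bounded below. -/
theorem PositiveDensityPart.exists_overlap {u : Vec d → Ω → Vec d}
    (h : PositiveDensityPart P fun _ : Unit => u) (hum : ∀ x, Measurable (u x)) {σ : ℝ}
    (hu : ∀ x, MemLp (u x) 2 P) (hσ : ∀ x, ∫ ω, ‖u x ω‖ ^ 2 ∂P ≤ σ ^ 2) {C : Set (Vec d)}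
    (hC : Bornology.IsBounded C) {M : ℝ} (hM : 0 ≤ M) :
    ∃ δ : ℝ, 0 < δ ∧ ∀ x ∈ C, ∀ y ∈ C, ∀ v w : Vec d, ‖v‖ ≤ M → ‖w‖ ≤ M →
      ∀ A, MeasurableSet A → δ ≤ P.real {ω | u x ω + v ∈ A} + P.real {ω | u y ω + w ∈ Aᶜ} := by
  obtain ⟨Ua, Ub, p, hdec, hind, hp, hinf⟩ := h ()
  replace hdec : ∀ x ω, u x ω = Ua x ω + Ub x ω := hdec
  have hpC := hinf C hC
  have hUb (x) : Measurable (Ub x) := by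
    have : Ub x = fun ω => u x ω - Ua x ω := by ext1 ω; rw [hdec]; simp
    rw [this]
    exact (hum x).sub (hind x).1
  have hvolpos (r : ℝ) (hr : 0 < r) : 0 < volume.real (Metric.ball (0 : Vec d) r) :=
    ENNReal.toReal_pos (Metric.measure_ball_pos _ _ hr).ne' measure_ball_lt_top.ne
  -- Uniform tightness of `Ub`: a large `Ub x` together with a small `Ua x` makes `u x` large. By
  -- independence and the lower bound `m` on the mass of small `Ua x`, Chebyshev for `u x` bounds
  -- the tail of `Ub x` by `1/2`.
  obtain ⟨M₀, hM₀, htight⟩ : ∃ M₀ : ℝ, 0 ≤ M₀ ∧ ∀ x ∈ C, 1 / 2 ≤ P.real {ω | ‖Ub x ω‖ ≤ M₀} := by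
    obtain ⟨ε, hε, hS⟩ := exists_uniform_density_bound hpC one_pos (θ := 1 / 2) (by norm_num)
    set m : ℝ := ε * (1 / 2 * volume.real (Metric.ball (0 : Vec d) 1)) with hm
    have hm0 : 0 < m := by have := hvolpos 1 one_pos; positivity
    obtain ⟨N, hN⟩ : ∃ N : ℝ, 0 < N ∧ σ ^ 2 / N ^ 2 ≤ m / 2 := by
      have hlim : Tendsto (fun N : ℝ => σ ^ 2 / N ^ 2) atTop (𝓝 0) :=
        tendsto_const_nhds.div_atTop (tendsto_pow_atTop two_ne_zero)
      obtain ⟨N, h1, h2⟩ := ((eventually_gt_atTop 0).and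
        (hlim.eventually (gt_mem_nhds (half_pos hm0)))).exists
      exact ⟨N, h1, h2.le⟩
    refine ⟨N + 1, by linarith, fun x hx => ?_⟩
    have ha : m ≤ P.real {ω | Ua x ω ∈ Metric.ball 0 1} := by
      refine le_trans ?_ (mul_measureReal_le_map (hind x).1 (hp x).1 (hp x).2
        (B := Metric.ball 0 1) hε.le Metric.isOpen_ball.measurableSet)
      refine mul_le_mul_of_nonneg_left ((hS x hx).trans_eq ?_) hε.le
      congr 1
      ext t
      simp only [Set.mem_ofPred_eq]
      tauto
    have hprod : P.real {ω | Ua x ω ∈ Metric.ball 0 1} * P.real {ω | N + 1 < ‖Ub x ω‖}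
        ≤ P.real {ω | N < ‖u x ω‖} := by
      have := (hind x).2.measure_inter_preimage_eq_mul (Metric.ball 0 1) {z | N + 1 < ‖z‖}
        Metric.isOpen_ball.measurableSet (measurableSet_lt measurable_const measurable_norm)
      have h2 : P.real {ω | Ua x ω ∈ Metric.ball 0 1} * P.real {ω | N + 1 < ‖Ub x ω‖}
          = P.real (Ua x ⁻¹' Metric.ball 0 1 ∩ Ub x ⁻¹' {z | N + 1 < ‖z‖}) := by
        rw [measureReal_def, measureReal_def, measureReal_def, this, ENNReal.toReal_mul]
        rfl
      rw [h2]
      refine measureReal_mono fun ω hω => ?_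
      have h3 : ‖Ua x ω‖ < 1 := by simpa using hω.1
      have h4 : N + 1 < ‖Ub x ω‖ := hω.2
      have h5 := norm_sub_le (u x ω) (Ua x ω)
      rw [hdec, add_sub_cancel_left, ← hdec] at h5
      show N < ‖u x ω‖
      linarith
    have hcheb := (measureReal_lt_norm_le_div_sq (hu x) (hσ x) hN.1).trans hN.2
    have hcompl : P.real {ω | ‖Ub x ω‖ ≤ N + 1} = 1 - P.real {ω | N + 1 < ‖Ub x ω‖} := by
      rw [← probReal_compl_eq_one_sub (measurableSet_lt measurable_const (hUb x).norm)]
      congr 1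
      ext ω
      simp
    have hnn : 0 ≤ P.real {ω | N + 1 < ‖Ub x ω‖} := measureReal_nonneg
    rw [hcompl]
    nlinarith
  -- Two sets filling `3/4` of the ball, translated inside a ball of relative volume `5/4`, overlap
  -- in at least `2 · 3/4 - 5/4 = 1/4` of the volume.
  obtain ⟨r, hr, hratio⟩ := exists_ball_ratio d (add_nonneg hM₀ hM)
  obtain ⟨ε, hε, hS⟩ := exists_uniform_density_bound hpC hr (θ := 3 / 4) (by norm_num)
  set K := volume.real (Metric.ball (0 : Vec d) r)
  have hK : 0 < K := hvolpos r hr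
  have hUa (x y : Vec d) (hx : x ∈ C) (hy : y ∈ C) (v w : Vec d) (hv : ‖v‖ ≤ M₀ + M)
      (hw : ‖w‖ ≤ M₀ + M) (A : Set (Vec d)) (hA : MeasurableSet A) :
      ε * (K / 4) ≤ P.real {ω | Ua x ω + v ∈ A} + P.real {ω | Ua y ω + w ∈ Aᶜ} := by
    have h1 := mul_measureReal_le_map (hind x).1 (hp x).1 (hp x).2 (B := Metric.ball 0 r) hε.le
      (A := {t | t + v ∈ A}) (measurable_id.add_const v hA)
    have h2 := mul_measureReal_le_map (hind y).1 (hp y).1 (hp y).2 (B := Metric.ball 0 r) hε.le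
      (A := {t | t + w ∈ Aᶜ}) (measurable_id.add_const w hA.compl)
    have h3 := le_measureReal_translate_add (fun t ht => ht.1) (fun t ht => ht.1) (hS x hx)
      (hS y hy) hv hw hA
    have h4 : ε * (K / 4) ≤ ε * (2 * (3 / 4 * K)
        - volume.real (Metric.ball (0 : Vec d) (r + (M₀ + M)))) :=
      mul_le_mul_of_nonneg_left (by linarith) hε.le
    have h5 := mul_le_mul_of_nonneg_left h3 hε.le
    rw [mul_add] at h5
    exact h4.trans (h5.trans (add_le_add h1 h2))
  -- Freeze `Ub x` at a value of norm at most `M₀`, which becomes part of the translation.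
  have hmix (x : Vec d) (hx : x ∈ C) (v : Vec d) (hv : ‖v‖ ≤ M) (A : Set (Vec d))
      (hA : MeasurableSet A) : ∃ v' : Vec d, ‖v'‖ ≤ M₀ + M ∧
        P.real {ω | Ua x ω + v' ∈ A} ≤ 2 * P.real {ω | u x ω + v ∈ A} := by
    obtain ⟨ω', hω', hle⟩ := exists_measureReal_le_two_mul (P := P)
      (m₁ := MeasurableSpace.comap (Ub x) inferInstance)
      (m₂ := MeasurableSpace.comap (Ua x) inferInstance) (hUb x).comap_le (hind x).1.comap_le
      ((IndepFun_iff_Indep _ _ _).1 (hind x).2).symm (comap_measurable (Ub x))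
      (D := {q | Ua x q.2 + (q.1 + v) ∈ A})
      (((((comap_measurable (Ua x)).comp
        (@measurable_snd _ _ _ (MeasurableSpace.comap (Ua x) inferInstance))).add
        ((@measurable_fst _ _ _ (MeasurableSpace.comap (Ua x) inferInstance)).add_const v)) hA))
      (htight x hx)
    refine ⟨Ub x ω' + v, (norm_add_le _ _).trans (add_le_add hω' hv), hle.trans_eq ?_⟩
    simp only [Set.mem_ofPred_eq, hdec, add_assoc]
  refine ⟨ε * (K / 4) / 2, by positivity, fun x hx y hy v w hv hw A hA => ?_⟩
  obtain ⟨v', hv', hlev⟩ := hmix x hx v hv A hA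
  obtain ⟨w', hw', hlew⟩ := hmix y hy w hw Aᶜ hA.compl
  linarith [hUa x y hx hy v' w' hv' hw' A hA]

/-- The overlap estimate for the laws of `x - s • (v + u y)`. -/
theorem PositiveDensityPart.exists_overlap_update {u : Vec d → Ω → Vec d}
    (h : PositiveDensityPart P fun _ : Unit => u) (hum : ∀ x, Measurable (u x)) {σ : ℝ}
    (hu : ∀ x, MemLp (u x) 2 P) (hσ : ∀ x, ∫ ω, ‖u x ω‖ ^ 2 ∂P ≤ σ ^ 2) {s : ℝ} (hs : 0 < s)
    {M : ℝ} (hM : 0 ≤ M) :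
    ∃ δ : ℝ, 0 < δ ∧ ∀ x y v x' y' v' : Vec d, ‖x‖ ≤ M → ‖y‖ ≤ M → ‖v‖ ≤ M →
      ‖x'‖ ≤ M → ‖y'‖ ≤ M → ‖v'‖ ≤ M → ∀ A, MeasurableSet A →
      δ ≤ P.real {ω | x - s • (v + u y ω) ∈ A} + P.real {ω | x' - s • (v' + u y' ω) ∈ Aᶜ} := by
  obtain ⟨δ, hδ, hov⟩ := h.exists_overlap hum hu hσ
    (Metric.isBounded_closedBall (x := (0 : Vec d)) (r := M))
    (M := M + s⁻¹ * M) (by positivity)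
  refine ⟨δ, hδ, fun x y v x' y' v' hx hy hv hx' hy' hv' A hA => ?_⟩
  have hnorm (x v : Vec d) (hx : ‖x‖ ≤ M) (hv : ‖v‖ ≤ M) : ‖v - s⁻¹ • x‖ ≤ M + s⁻¹ * M := by
    refine (norm_sub_le _ _).trans (add_le_add hv ?_)
    rw [norm_smul, Real.norm_of_nonneg (inv_nonneg.2 hs.le)]
    gcongr
  have he (x z v : Vec d) : x - s • (v + z) = (-s) • (z + (v - s⁻¹ • x)) := by
    simp only [smul_add, smul_sub, neg_smul, smul_smul, neg_mul, mul_inv_cancel₀ hs.ne', one_smul]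
    abel
  have := hov y (by simpa using hy) y' (by simpa using hy') (v - s⁻¹ • x) (v' - s⁻¹ • x')
    (hnorm x v hx hv) (hnorm x' v' hx' hv') ((fun z => (-s) • z) ⁻¹' A)
    (measurable_const_smul (-s) hA)
  simp only [he]
  exact this

end Overlap

/-! ### From Harris' theorem to the iterates; bias and noise moments. -/

section Chain

variable {d : ℕ} {Ω : Type*} [mΩ : MeasurableSpace Ω] {P : Measure Ω}

theorem IIDFields.map_eq {κ : Type*} {U : κ → Vec d → Ω → Vec d} (h : IIDFields P U) (k l : κ) (x : Vec d) :
    P.map (U k x) = P.map (U l x) :=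
  ((h.ident k l).comp (measurable_pi_apply x)).map_eq

theorem norm_le_of_sq_norm_sub_le {xs x : Vec d} {r : ℝ} (h : ‖x - xs‖ ^ 2 ≤ r) :
    ‖x‖ ≤ ‖xs‖ + 1 + r := by
  have h1 := norm_add_le (x - xs) xs
  rw [sub_add_cancel] at h1
  nlinarith [sq_nonneg (‖x - xs‖ - 1), norm_nonneg (x - xs)]

/-- Harris' theorem for the Lyapunov function `‖x - xs‖ ^ 2`. -/
theorem exists_isGeometricLimit {Q : Kernel (Vec d) (Vec d)} [IsMarkovKernel Q]
    {X : Vec d → ℕ → Ω → Vec d} {xs : Vec d} {κ b : ℝ}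
    (h : GeometricDrift Q (fun x => ‖x - xs‖ ^ 2) κ b) (hκ : κ < 1) (hb : 0 ≤ b)
    (hS : ∀ r, ∃ δ, 0 < δ ∧ OverlapOn Q {x | ‖x - xs‖ ^ 2 ≤ r} δ)
    (hX : ∀ x₀ n, Measurable (X x₀ n) ∧ P.map (X x₀ n) = evolve Q (Measure.dirac x₀) n) :
    ∃ π : Measure (Vec d), IsGeometricLimit P Q X π ∧
      Integrable (fun x => ‖x - xs‖ ^ 2) π ∧ ∫ x, ‖x - xs‖ ^ 2 ∂π ≤ b / (1 - κ) := by
  -- Harris' theorem asks for `0 ≤ κ` and `0 < b`, so the constants are enlarged; the final moment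
  -- bound goes back to the original ones.
  have h' : GeometricDrift Q (fun x => ‖x - xs‖ ^ 2) (max κ 0) (b + 1) :=
    ⟨h.measurable, h.nonneg, h.integrable, fun x => (h.drift x).trans
      (add_le_add (mul_le_mul_of_nonneg_right (le_max_left _ _) (h.nonneg x)) (by linarith))⟩
  obtain ⟨π, hπ, hinv, hWπ, huniq, β, ρ, hβ, hρ0, hρ1, hconv⟩ :=
    h'.exists_invariant (le_max_right _ _) (max_lt hκ one_pos) (by linarith) hS
  set w : ℝ := ∫ x, ‖x - xs‖ ^ 2 ∂π with hw
  have hw0 : 0 ≤ w := integral_nonneg h.nonneg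
  have hdirac (x : Vec d) : Integrable (fun x => ‖x - xs‖ ^ 2) (Measure.dirac x) :=
    integrable_dirac' h.measurable.stronglyMeasurable (by simp)
  refine ⟨π, ⟨hπ, hinv, huniq, ?_, ?_, ?_⟩, hWπ, ?_⟩
  · refine Integrable.mono' ((hWπ.const_mul 2).add (integrable_const (2 * ‖xs‖ ^ 2)))
      (by fun_prop) (ae_of_all _ fun x => ?_)
    have h1 := norm_add_le (x - xs) xs
    rw [sub_add_cancel] at h1
    simp only [Pi.add_apply]
    rw [Real.norm_of_nonneg (by positivity)]
    nlinarith [sq_nonneg (‖x - xs‖ - ‖xs‖), norm_nonneg (x - xs), norm_nonneg xs, norm_nonneg x]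
  · rintro f hf ⟨Gf, hGf, hfb⟩
    set a : ℝ := Gf * (2 + ‖xs‖ + β⁻¹) with ha
    have ha0 : 0 < a := by positivity
    have hosc : WeightedOsc (fun x => ‖x - xs‖ ^ 2) β a f := by
      refine ⟨0, fun x => ?_⟩
      rw [sub_zero, ha, mul_assoc]
      refine (hfb x).trans (mul_le_mul_of_nonneg_left ?_ hGf.le)
      have h1 := norm_le_of_sq_norm_sub_le (le_refl (‖x - xs‖ ^ 2))
      have h2 : (2 + ‖xs‖ + β⁻¹) * (1 + β * ‖x - xs‖ ^ 2) = 2 + ‖xs‖ + ‖x - xs‖ ^ 2 + β⁻¹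
          + (2 + ‖xs‖) * (β * ‖x - xs‖ ^ 2) := by
        field_simp; ring
      rw [h2]
      have h3 : 0 ≤ β⁻¹ + (2 + ‖xs‖) * (β * ‖x - xs‖ ^ 2) := by positivity
      linarith
    refine ⟨hosc.integrable hf hWπ, ρ, hρ0, hρ1, fun x₀ =>
      ⟨a * (2 + β * (‖x₀ - xs‖ ^ 2 + w)), by positivity, fun n => ⟨?_, ?_⟩⟩⟩
    · have := hosc.integrable hf (h'.integrable_evolve (hdirac x₀) n)
      rw [← (hX x₀ n).2] at this
      exact this.comp_measurable (hX x₀ n).1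
    · have := hconv a f ha0 hf hosc x₀ n
      rw [← (hX x₀ n).2, integral_map (hX x₀ n).1.aemeasurable hf.aestronglyMeasurable] at this
      rwa [mul_comm (ρ ^ n)] at this
  · refine ⟨ρ, hρ0, hρ1, fun x₀ =>
      ⟨1 * (2 + β * (‖x₀ - xs‖ ^ 2 + w)), by positivity, fun n => ?_⟩⟩
    have : Nonempty {A : Set (Vec d) // MeasurableSet A} := ⟨⟨∅, MeasurableSet.empty⟩⟩
    refine ciSup_le fun A => ?_
    have := hconv 1 _ one_pos (measurable_one.indicator A.2)
      (weightedOsc_indicator h.nonneg hβ.le A.1) x₀ n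
    rw [integral_indicator_one A.2, integral_indicator_one A.2, ← (hX x₀ n).2] at this
    rwa [mul_comm (ρ ^ n)] at this
  -- Invariance turns the drift into `w ≤ κ w + b`.
  · rw [le_div_iff₀ (by linarith)]
    have := h.integral_bind_le hWπ
    rw [hinv.def] at this
    linarith

variable [IsProbabilityMeasure P]

theorem updateKernel_apply {F : Vec d → Ω → Vec d} (hF : Measurable fun q : Vec d × Ω => F q.1 q.2)
    (x : Vec d) : updateKernel P F x = P.map (F x) := by
  have hFx : Measurable (F x) := hF.comp measurable_prodMk_left
  ext A hA
  rw [updateKernel, Kernel.map_apply _ hF, Measure.map_apply hF hA, Kernel.prod_apply,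
    Kernel.id_apply, Kernel.const_apply, Measure.prod_apply (hF hA), lintegral_dirac',
    Measure.map_apply hFx hA]
  · rfl
  · exact measurable_measure_prodMk_left (hF hA)

theorem isMarkovKernel_updateKernel {F : Vec d → Ω → Vec d}
    (hF : Measurable fun q : Vec d × Ω => F q.1 q.2) : IsMarkovKernel (updateKernel P F) :=
  Kernel.IsMarkovKernel.map _ hF

theorem measurable_eval_field {Ω' E F : Type*} [mE : MeasurableSpace E] [MeasurableSpace F]
    {m m₂ : MeasurableSpace Ω'} (h : m₂ ≤ m) {Z : Ω' → E} (hZ : Measurable[m] Z) {g : E × Ω' → F}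
    (hg : Measurable[MeasurableSpace.prod mE m₂] g) : Measurable[m] fun ω => g (Z ω, ω) :=
  hg.comp (Measurable.prodMk hZ (measurable_id'' h))

/-- The laws of the iterates `X (n + 1) = F n (X n)` of independent random maps with a common
one-step law evolve according to the corresponding kernel. -/
theorem map_iterate_eq_evolve {𝒜 : ℕ → MeasurableSpace Ω} (hle : ∀ n, 𝒜 n ≤ mΩ)
    (hind : ∀ n, Indep (⨆ k ∈ Set.Iio n, 𝒜 k) (𝒜 n) P) {F : ℕ → Vec d → Ω → Vec d}
    (hF : ∀ n, Measurable[MeasurableSpace.prod inferInstance (𝒜 n)]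
      fun q : Vec d × Ω => F n q.1 q.2)
    {Q : Kernel (Vec d) (Vec d)} (hQ : ∀ n x, P.map (F n x) = Q x) {X : ℕ → Ω → Vec d}
    {x₀ : Vec d} (hX0 : X 0 = fun _ => x₀) (hX : ∀ n, X (n + 1) = fun ω => F n (X n ω) ω) (n : ℕ) :
    Measurable (X n) ∧ P.map (X n) = evolve Q (Measure.dirac x₀) n := by
  have hsup (n : ℕ) : ⨆ k ∈ Set.Iio n, 𝒜 k ≤ mΩ := iSup₂_le fun k _ => hle k
  have hadapt (n : ℕ) : Measurable[⨆ k ∈ Set.Iio n, 𝒜 k] (X n) := by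
    induction n with
    | zero => rw [hX0]; exact measurable_const
    | succ n ih =>
      rw [hX]
      have hn : 𝒜 n ≤ ⨆ k ∈ Set.Iio (n + 1), 𝒜 k := le_iSup₂_of_le n (Nat.lt_succ_self n) le_rfl
      refine measurable_eval_field hn (ih.mono ?_ le_rfl) (hF n)
      exact iSup₂_le fun k hk => le_iSup₂_of_le k (Nat.lt_succ_of_lt hk) le_rfl
  -- By `hadapt`, `X n` depends only on the maps before time `n`, so it is independent of `F n`.
  have hmeas (n : ℕ) : Measurable (X n) := (hadapt n).mono (hsup n) le_rfl
  refine ⟨hmeas n, ?_⟩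
  induction n with
  | zero => rw [hX0, Measure.map_const, measure_univ, one_smul, evolve]
  | succ n ih =>
    ext A hA
    have h := measure_decouple (hsup n) (hle n) (hind n) (hadapt n) (D := _ ⁻¹' A) (hF n hA)
    rw [evolve, ← ih, Measure.bind_apply hA Q.aemeasurable,
      lintegral_map (Q.measurable_coe hA) (hmeas n), Measure.map_apply (hmeas (n + 1)) hA, hX]
    refine h.trans (lintegral_congr fun ω' => ?_)
    rw [← hQ n, Measure.map_apply _ hA]
    · rfl
    · exact (measurable_prod_mono (hle n) (hF n)).comp measurable_prodMk_left

/-- The pointwise inequality `t ≤ t² / (2√D) + √D / 2` plays the role of Jensen: once `∫ ‖x - y‖² ≤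
D`, it gives `∫ ‖x - y‖ ≤ √D`, together with integrability. -/
theorem lipschitzBias_of_integral_sq_le {V : Vec d → Vec d} {π : Measure (Vec d)}
    [IsProbabilityMeasure π] {xs : Vec d} {B c D : ℝ}
    (hint : Integrable (fun x => ‖x - xs‖ ^ 2) π) (hB : ∫ x, ‖x - xs‖ ^ 2 ∂π ≤ B)
    (hsol : ∀ y ∈ solutions V, ‖y - xs‖ ^ 2 ≤ c) (hD0 : 0 < D) (hD : 2 * B + 2 * c ≤ D) :
    LipschitzBias V π D := by
  intro f Lf hf y hy
  have hs : 0 < √D := Real.sqrt_pos.2 hD0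
  have hmaj₀ : Integrable (fun x => 2 * ‖x - xs‖ ^ 2 + 2 * c) π :=
    (hint.const_mul 2).add (integrable_const _)
  have hmaj : Integrable (fun x => (2 * ‖x - xs‖ ^ 2 + 2 * c) / √D / 2 + √D / 2) π :=
    ((hmaj₀.div_const _).div_const _).add (integrable_const _)
  have hnorm (x : Vec d) : ‖x - y‖ ≤ (2 * ‖x - xs‖ ^ 2 + 2 * c) / √D / 2 + √D / 2 := by
    have h1 : ‖x - y‖ ^ 2 ≤ 2 * ‖x - xs‖ ^ 2 + 2 * c := by
      have h2 := norm_sub_le (x - xs) (y - xs)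
      rw [sub_sub_sub_cancel_right] at h2
      nlinarith [hsol y hy, sq_nonneg (‖x - xs‖ - ‖y - xs‖), norm_nonneg (x - xs),
        norm_nonneg (y - xs), norm_nonneg (x - y)]
    have h3 : ‖x - y‖ ≤ ‖x - y‖ ^ 2 / √D / 2 + √D / 2 := by
      have : ‖x - y‖ ^ 2 / √D / 2 + √D / 2 - ‖x - y‖ = (‖x - y‖ - √D) ^ 2 / √D / 2 := by
        field_simp; ring
      have h4 : 0 ≤ (‖x - y‖ - √D) ^ 2 / √D / 2 := by positivity
      linarith
    refine h3.trans ?_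
    gcongr
  have hnormi : Integrable (fun x => ‖x - y‖) π :=
    hmaj.mono' (by fun_prop) (ae_of_all _ fun x => by rw [norm_norm]; exact hnorm x)
  have hlip (x : Vec d) : |f x - f y| ≤ Lf * ‖x - y‖ := by
    simpa [Real.dist_eq, dist_eq_norm] using hf.dist_le_mul x y
  have hfi : Integrable (fun x => f x - f y) π :=
    (hnormi.const_mul (Lf : ℝ)).mono' (by have := hf.continuous; fun_prop)
      (ae_of_all _ fun x => hlip x)
  have hfi' : Integrable f π := by
    have := hfi.add (integrable_const (f y))
    rwa [show (fun x => f x - f y) + (fun _ => f y) = f from funext fun x => sub_add_cancel _ _]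
      at this
  have e1 : ∫ x, f x ∂π - f y = ∫ x, (f x - f y) ∂π := by
    rw [integral_sub hfi' (integrable_const _)]; simp
  rw [e1]
  calc |∫ x, (f x - f y) ∂π| ≤ ∫ x, |f x - f y| ∂π := abs_integral_le_integral_abs
    _ ≤ ∫ x, Lf * ‖x - y‖ ∂π := integral_mono hfi.abs (hnormi.const_mul _) hlip
    _ = Lf * ∫ x, ‖x - y‖ ∂π := integral_const_mul _ _
    _ ≤ Lf * √D := by
      refine mul_le_mul_of_nonneg_left ?_ Lf.2
      refine (integral_mono hnormi hmaj hnorm).trans ?_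
      rw [integral_add ((hmaj₀.div_const _).div_const _) (integrable_const _), integral_div, integral_div,
        integral_add (hint.const_mul 2) (integrable_const _), integral_const_mul]
      simp only [integral_const, probReal_univ, smul_eq_mul, one_mul]
      have : (2 * ∫ x, ‖x - xs‖ ^ 2 ∂π + 2 * c) / √D ≤ √D := by
        rw [div_le_iff₀ hs, Real.mul_self_sqrt hD0.le]
        linarith
      linarith

theorem sq_norm_sub_le_of_solution {V : Vec d → Vec d} {lam μ : ℝ} (hμ : 0 < μ) {xs : Vec d}
    (h : ∀ x, μ * ‖x - xs‖ ^ 2 - lam ≤ inner ℝ (V x) (x - xs)) {y : Vec d}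
    (hy : y ∈ solutions V) : ‖y - xs‖ ^ 2 ≤ lam / μ := by
  have h1 := h y
  have h2 : V y = 0 := hy
  rw [h2, inner_zero_left] at h1
  rw [le_div_iff₀ hμ]
  linarith

/-! ### Noise -/

theorem integrable_and_integral_sq_norm_sub_smul_le {u : Ω → Vec d} (hu : MemLp u 2 P)
    (h0 : ∫ ω, u ω ∂P = 0) {σ : ℝ} (hσ : ∫ ω, ‖u ω‖ ^ 2 ∂P ≤ σ ^ 2) (a : Vec d) (s : ℝ) :
    Integrable (fun ω => ‖a - s • u ω‖ ^ 2) P ∧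
      ∫ ω, ‖a - s • u ω‖ ^ 2 ∂P ≤ ‖a‖ ^ 2 + s ^ 2 * σ ^ 2 := by
  have hui : Integrable u P := hu.integrable (by norm_num)
  have hu2 : Integrable (fun ω => ‖u ω‖ ^ 2) P := (memLp_two_iff_integrable_sq_norm hu.1).1 hu
  have hin : Integrable (fun ω => inner ℝ a (u ω)) P := hui.const_inner a
  have e (ω : Ω) : ‖a - s • u ω‖ ^ 2
      = ‖a‖ ^ 2 - 2 * s * inner ℝ a (u ω) + s ^ 2 * ‖u ω‖ ^ 2 := by
    rw [norm_sub_sq_real, real_inner_smul_right, norm_smul, mul_pow, Real.norm_eq_abs, sq_abs]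
    ring
  have hi1 : Integrable (fun ω => ‖a‖ ^ 2 - 2 * s * inner ℝ a (u ω)) P :=
    (integrable_const _).sub (hin.const_mul _)
  simp_rw [e]
  refine ⟨hi1.add (hu2.const_mul _), ?_⟩
  rw [integral_add hi1 (hu2.const_mul _), integral_sub (integrable_const _) (hin.const_mul _),
    integral_const_mul, integral_const_mul, integral_inner hui, h0, inner_zero_right]
  simp only [integral_const, probReal_univ, smul_eq_mul, one_mul, mul_zero, sub_zero]
  gcongr

variable {κ : Type*} {ℱ : Filtration ℕ mΩ} {time : κ → ℕ} {U : κ → Vec d → Ω → Vec d} {σ : ℝ}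

theorem OracleNoise.integral_eq_zero (h : OracleNoise P ℱ time U σ) (k : κ) (x : Vec d) :
    ∫ ω, U k x ω ∂P = 0 := by
  rw [← integral_condExp (ℱ.le (time k)), integral_congr_ae (h.zero_mean k x)]
  simp

theorem OracleNoise.integral_sq_le (h : OracleNoise P ℱ time U σ) (k : κ) (x : Vec d) :
    ∫ ω, ‖U k x ω‖ ^ 2 ∂P ≤ σ ^ 2 := by
  rw [← integral_condExp (ℱ.le (time k))]
  refine (integral_mono_ae integrable_condExp (integrable_const _) (h.second_moment k x)).trans ?_
  simp

end Chain

/-! ### Drift, overlap and constants for SGDA. -/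

section SGDA

variable {d : ℕ} {Ω : Type*} [mΩ : MeasurableSpace Ω] {P : Measure Ω}
  {V : Vec d → Vec d} {ℱ : Filtration ℕ mΩ} {U : ℕ → Vec d → Ω → Vec d} {σ γ : ℝ}

theorem measurable_sgdaStep {Ω' : Type*} {m : MeasurableSpace Ω'} (hV : Measurable V)
    {u : Vec d → Ω' → Vec d}
    (hu : Measurable[MeasurableSpace.prod inferInstance m] fun q : Vec d × Ω' => u q.1 q.2) :
    Measurable[MeasurableSpace.prod inferInstance m]
      fun q : Vec d × Ω' => sgdaStep V γ (fun y => u y q.2) q.1 :=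
  measurable_fst.sub (((hV.comp measurable_fst).add hu).const_smul γ)

theorem OracleNoise.measurable_field {κ : Type*} {time : κ → ℕ} {U : κ → Vec d → Ω → Vec d}
    (h : OracleNoise P ℱ time U σ) (k : κ) : Measurable fun q : Vec d × Ω => U k q.1 q.2 :=
  measurable_prod_mono (ℱ.le _) (h.adapted k)

theorem OracleNoise.measurable_apply {κ : Type*} {time : κ → ℕ} {U : κ → Vec d → Ω → Vec d}
    (h : OracleNoise P ℱ time U σ) (k : κ) (x : Vec d) : Measurable (U k x) :=
  (h.measurable_field k).comp measurable_prodMk_left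

variable [IsProbabilityMeasure P]

theorem map_sgda_eq_evolve (hV : Measurable V) (h : OracleNoise P ℱ id U σ) (x₀ : Vec d) (n : ℕ) :
    Measurable (sgda V γ U x₀ n) ∧
      P.map (sgda V γ U x₀ n) = evolve (sgdaKernel P V γ U) (Measure.dirac x₀) n := by
  obtain ⟨𝒢, hle, hind, hmeas⟩ := h.iid.indep
  refine map_iterate_eq_evolve (F := fun n x ω => sgdaStep V γ (fun y => U n y ω) x) hle
    (fun n => ?_) (fun n => measurable_sgdaStep hV (hmeas n)) (fun n x => ?_) rfl
    (fun n => rfl) n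
  · have := indep_iSup_of_disjoint hle hind (S := Set.Iio n) (T := {n}) (by simp)
    simpa using this
  · rw [sgdaKernel, updateKernel_apply (measurable_sgdaStep hV (h.measurable_field 0))]
    have hg : Measurable fun z : Vec d => x - γ • (V x + z) := by fun_prop
    have e (k : ℕ) : P.map (fun ω => sgdaStep V γ (fun y => U k y ω) x)
        = (P.map (U k x)).map fun z => x - γ • (V x + z) := by
      rw [Measure.map_map hg (h.measurable_apply k x)]; rfl
    rw [e n, e 0, h.iid.map_eq n 0 x]

theorem sq_norm_sub_smul_le_of_linearGrowth {lam μ G : ℝ} (hG : 0 < G) {xs : Vec d}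
    (hxs : ∀ x, μ * ‖x - xs‖ ^ 2 - lam ≤ inner ℝ (V x) (x - xs)) (hVG : LinearGrowth V G)
    (hγ : 0 < γ) (hγμ : γ < μ / G ^ 2) (x : Vec d) :
    ‖x - xs - γ • V x‖ ^ 2 ≤ (1 - γ * μ / 2) * ‖x - xs‖ ^ 2
      + (2 * γ * lam + 3 * γ ^ 2 * G ^ 2 * (1 + ‖xs‖) ^ 2) := by
  rw [norm_sub_sq_real, real_inner_smul_right, norm_smul, mul_pow, Real.norm_of_nonneg hγ.le,
    real_inner_comm]
  set e := ‖x - xs‖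
  have hγ' : γ * G ^ 2 ≤ μ := ((lt_div_iff₀ (by positivity)).1 hγμ).le
  have h1 : ‖V x‖ ^ 2 ≤ G ^ 2 * (3 * (1 + ‖xs‖) ^ 2 + 3 / 2 * e ^ 2) := by
    have h2 := norm_add_le (x - xs) xs
    rw [sub_add_cancel] at h2
    have h3 : ‖V x‖ ≤ G * ((1 + ‖xs‖) + e) :=
      (hVG x).trans (mul_le_mul_of_nonneg_left (by linarith) hG.le)
    have h4 := pow_le_pow_left₀ (norm_nonneg _) h3 2
    rw [mul_pow] at h4
    refine h4.trans (mul_le_mul_of_nonneg_left ?_ (by positivity))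
    -- The split `(a + e)² ≤ 3a² + (3/2)e²` is chosen so that, after `γG² ≤ μ`, the growth term
    -- costs `(3/2)γμe²` of the gain `2γμe²`.
    nlinarith [sq_nonneg (2 * (1 + ‖xs‖) - e)]
  have h5 := mul_le_mul_of_nonneg_left h1 (sq_nonneg γ)
  have h6 : γ ^ 2 * (G ^ 2 * (3 / 2 * e ^ 2)) ≤ γ * μ * (3 / 2 * e ^ 2) := by
    have : γ * (γ * G ^ 2) ≤ γ * μ := mul_le_mul_of_nonneg_left hγ' hγ.le
    have := mul_le_mul_of_nonneg_right this (show 0 ≤ 3 / 2 * e ^ 2 by positivity)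
    linarith
  have h7 := mul_le_mul_of_nonneg_left (hxs x) (show 0 ≤ 2 * γ by positivity)
  linarith

theorem geometricDrift_sgda (hV : Measurable V) (h : OracleNoise P ℱ id U σ) {lam μ G : ℝ}
    (hG : 0 < G) {xs : Vec d} (hxs : ∀ x, μ * ‖x - xs‖ ^ 2 - lam ≤ inner ℝ (V x) (x - xs))
    (hVG : LinearGrowth V G) (hγ : 0 < γ) (hγμ : γ < μ / G ^ 2) :
    GeometricDrift (sgdaKernel P V γ U) (fun x => ‖x - xs‖ ^ 2) (1 - γ * μ / 2)
      (2 * γ * lam + 3 * γ ^ 2 * G ^ 2 * (1 + ‖xs‖) ^ 2 + γ ^ 2 * σ ^ 2) := by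
  have hstep := measurable_sgdaStep (γ := γ) hV (h.measurable_field 0)
  have hm : Measurable fun x : Vec d => ‖x - xs‖ ^ 2 := by fun_prop
  have key (x : Vec d) := integrable_and_integral_sq_norm_sub_smul_le (h.sq_integrable 0 x)
    (h.integral_eq_zero 0 x) (h.integral_sq_le 0 x) (x - xs - γ • V x) γ
  have he (x : Vec d) (ω : Ω) : x - xs - γ • V x - γ • U 0 x ω
      = sgdaStep V γ (fun y => U 0 y ω) x - xs := by
    rw [sgdaStep, smul_add]; abel
  simp only [he] at key
  have hsx (x : Vec d) : Measurable fun ω => sgdaStep V γ (fun y => U 0 y ω) x :=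
    hstep.comp measurable_prodMk_left
  refine ⟨hm, fun x => by positivity, fun x => ?_, fun x => ?_⟩
  · rw [sgdaKernel, updateKernel_apply hstep,
      integrable_map_measure hm.aestronglyMeasurable (hsx x).aemeasurable]
    exact (key x).1
  · rw [sgdaKernel, updateKernel_apply hstep,
      integral_map (hsx x).aemeasurable hm.aestronglyMeasurable]
    have := sq_norm_sub_smul_le_of_linearGrowth hG hxs hVG hγ hγμ x
    linarith [(key x).2]

theorem measureReal_updateKernel {F : Vec d → Ω → Vec d}
    (hF : Measurable fun q : Vec d × Ω => F q.1 q.2) (x : Vec d) {A : Set (Vec d)}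
    (hA : MeasurableSet A) : (updateKernel P F x).real A = P.real {ω | F x ω ∈ A} := by
  have hFx : Measurable (F x) := hF.comp measurable_prodMk_left
  rw [updateKernel_apply hF, measureReal_def, Measure.map_apply hFx hA]
  rfl

theorem overlapOn_sgda (hV : Measurable V) (h : OracleNoise P ℱ id U σ)
    (hp : PositiveDensityPart P U) {G : ℝ} (hG : 0 < G) (hVG : LinearGrowth V G) (hγ : 0 < γ)
    (xs : Vec d) (r : ℝ) :
    ∃ δ, 0 < δ ∧ OverlapOn (sgdaKernel P V γ U) {x | ‖x - xs‖ ^ 2 ≤ r} δ := by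
  have hstep := measurable_sgdaStep (γ := γ) hV (h.measurable_field 0)
  set N : ℝ := max (‖xs‖ + 1 + r) 0 with hN
  have hN0 : 0 ≤ N := le_max_right _ _
  obtain ⟨δ, hδ, hov⟩ := PositiveDensityPart.exists_overlap_update (u := U 0) (fun _ => hp 0)
    (h.measurable_apply 0) (h.sq_integrable 0) (h.integral_sq_le 0) hγ
    (M := N + G * (1 + N)) (by positivity)
  have hb (x : Vec d) (hx : ‖x - xs‖ ^ 2 ≤ r) :
      ‖x‖ ≤ N + G * (1 + N) ∧ ‖V x‖ ≤ N + G * (1 + N) := by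
    have h1 : ‖x‖ ≤ N := (norm_le_of_sq_norm_sub_le hx).trans (le_max_left _ _)
    have h2 : ‖V x‖ ≤ G * (1 + N) :=
      (hVG x).trans (mul_le_mul_of_nonneg_left (by linarith) hG.le)
    have h3 : 0 ≤ G * (1 + N) := by positivity
    constructor <;> linarith
  refine ⟨δ, hδ, fun x hx y hy A hA => ?_⟩
  rw [sgdaKernel, measureReal_updateKernel hstep x hA, measureReal_updateKernel hstep y hA.compl]
  exact hov x x (V x) y y (V y) (hb x hx).1 (hb x hx).1 (hb x hx).2 (hb y hy).1 (hb y hy).1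
    (hb y hy).2 A hA

theorem exists_isGeometricLimit_sgda (hV : Measurable V) {R lam μ G : ℝ} (hG : 0 < G)
    (hR : ∃ xs ∈ solutions V, ‖xs‖ ≤ R) (hlam : 0 ≤ lam) (hμ : 0 < μ)
    (hmon : WeakQuasiStronglyMonotone V lam μ) (hVG : LinearGrowth V G) (hγ : 0 < γ)
    (hγμ : γ < μ / G ^ 2) (h : OracleNoise P ℱ id U σ) (hp : PositiveDensityPart P U) :
    ∃ π : Measure (Vec d), IsGeometricLimit P (sgdaKernel P V γ U) (sgda V γ U) π ∧
      LipschitzBias V π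
        ((24 * G ^ 2 * (1 + |R|) ^ 2 + 34 + 4 * σ ^ 2) * (max lam γ / μ)) := by
  obtain ⟨xs, hxs, hmon⟩ := hmon
  have hMarkov : IsMarkovKernel (sgdaKernel P V γ U) :=
    isMarkovKernel_updateKernel (measurable_sgdaStep hV (h.measurable_field 0))
  have hγμ0 : 0 < γ * μ := mul_pos hγ hμ
  obtain ⟨π, hπ, hint, hle⟩ := exists_isGeometricLimit
    (geometricDrift_sgda hV h hG hmon hVG hγ hγμ) (by linarith) (by positivity)
    (overlapOn_sgda hV h hp hG hVG hγ xs) (map_sgda_eq_evolve hV h)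
  have := hπ.prob
  have hmax : 0 < max lam γ := hγ.trans_le (le_max_right _ _)
  refine ⟨π, hπ, lipschitzBias_of_integral_sq_le hint hle
    (fun y hy => sq_norm_sub_le_of_solution hμ hmon hy) (by positivity) ?_⟩
  obtain ⟨z, hz, hzR⟩ := hR
  have hγ' : γ * G ^ 2 ≤ μ := ((lt_div_iff₀ (by positivity)).1 hγμ).le
  -- The centre `xs` need not be the solution of norm at most `R`, but the two are within `√(lam /
  -- μ)` of each other.
  have hsq : (1 + ‖xs‖) ^ 2 ≤ 2 * (1 + |R|) ^ 2 + 2 * (lam / μ) := by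
    have h1 := sq_norm_sub_le_of_solution hμ hmon hz
    have h2 := norm_sub_le z (z - xs)
    rw [sub_sub_cancel] at h2
    have h3 : 1 + ‖xs‖ ≤ (1 + |R|) + ‖z - xs‖ := by linarith [le_abs_self R]
    have h4 := pow_le_pow_left₀ (by positivity) h3 2
    nlinarith [sq_nonneg ((1 + |R|) - ‖z - xs‖)]
  have hb : 2 * γ * lam + 3 * γ ^ 2 * G ^ 2 * (1 + ‖xs‖) ^ 2 + γ ^ 2 * σ ^ 2
      ≤ γ * (8 * lam + 6 * G ^ 2 * (1 + |R|) ^ 2 * γ + σ ^ 2 * γ) := by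
    -- The step-size condition cancels the `1 / μ` brought in by `hsq`, which keeps `K` free of `μ`.
    have h1 : γ * G ^ 2 * (lam / μ) ≤ lam :=
      (mul_le_mul_of_nonneg_right hγ' (by positivity)).trans_eq (by field_simp)
    have h2 : 3 * γ ^ 2 * G ^ 2 * (1 + ‖xs‖) ^ 2
        ≤ 3 * γ ^ 2 * G ^ 2 * (2 * (1 + |R|) ^ 2 + 2 * (lam / μ)) :=
      mul_le_mul_of_nonneg_left hsq (by positivity)
    have h3 := mul_le_mul_of_nonneg_left h1 (show 0 ≤ 6 * γ by positivity)
    linarith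
  have hdiv : (2 * γ * lam + 3 * γ ^ 2 * G ^ 2 * (1 + ‖xs‖) ^ 2 + γ ^ 2 * σ ^ 2)
      / (1 - (1 - γ * μ / 2))
      ≤ 2 * (8 * lam + 6 * G ^ 2 * (1 + |R|) ^ 2 * γ + σ ^ 2 * γ) / μ := by
    rw [sub_sub_cancel, div_le_div_iff₀ (by positivity) hμ]
    have := mul_le_mul_of_nonneg_right hb hμ.le
    linarith
  calc _ ≤ 2 * (2 * (8 * lam + 6 * G ^ 2 * (1 + |R|) ^ 2 * γ + σ ^ 2 * γ) / μ)
        + 2 * (lam / μ) := by linarith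
    _ = (34 * lam + (24 * G ^ 2 * (1 + |R|) ^ 2 + 4 * σ ^ 2) * γ) / μ := by ring
    _ ≤ (34 * max lam γ + (24 * G ^ 2 * (1 + |R|) ^ 2 + 4 * σ ^ 2) * max lam γ) / μ := by
      gcongr
      · exact le_max_left _ _
      · exact le_max_right _ _
    _ = _ := by ring

end SGDA

/-! ### Drift, overlap and constants for SEG. -/

section SEG

variable {d : ℕ} {Ω : Type*} [mΩ : MeasurableSpace Ω] {P : Measure Ω}
  {V : Vec d → Vec d} {ℱ : Filtration ℕ mΩ} {U U' : ℕ → Vec d → Ω → Vec d} {σ α γ : ℝ}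

theorem measurable_segStep {Ω' : Type*} {m : MeasurableSpace Ω'} (hV : Measurable V)
    {u u' : Vec d → Ω' → Vec d}
    (hu : Measurable[MeasurableSpace.prod inferInstance m] fun q : Vec d × Ω' => u q.1 q.2)
    (hu' : Measurable[MeasurableSpace.prod inferInstance m] fun q : Vec d × Ω' => u' q.1 q.2) :
    Measurable[MeasurableSpace.prod inferInstance m] fun q : Vec d × Ω' =>
      segStep V α γ (fun y => u y q.2) (fun y => u' y q.2) q.1 := by
  have hy := measurable_sgdaStep (γ := γ) hV hu
  exact measurable_fst.sub (((hV.comp hy).add (hu'.comp (hy.prodMk measurable_snd))).const_smul (α * γ))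

theorem integrable_and_integral_le_of_lintegral_le {g : Ω → ℝ} (hg : Measurable g)
    (hg0 : ∀ ω, 0 ≤ g ω) {c : ℝ} (hc : 0 ≤ c)
    (h : ∫⁻ ω, ENNReal.ofReal (g ω) ∂P ≤ ENNReal.ofReal c) :
    Integrable g P ∧ ∫ ω, g ω ∂P ≤ c := by
  refine ⟨⟨hg.aestronglyMeasurable, ?_⟩, ?_⟩
  · rw [hasFiniteIntegral_iff_ofReal (ae_of_all _ hg0)]
    exact h.trans_lt ENNReal.ofReal_lt_top
  · rw [integral_eq_lintegral_of_nonneg_ae (ae_of_all _ hg0) hg.aestronglyMeasurable]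
    exact ENNReal.toReal_le_of_le_ofReal hc h

/-- The update of SEG is the value of an affine function of the second noise at the look-ahead
point, which is independent of it. -/
theorem OracleNoise.exists_seg_decoupling {time : ℕ ⊕ ℕ → ℕ} (hV : Measurable V)
    (h : OracleNoise P ℱ time (Sum.elim U U') σ) (n : ℕ) (x : Vec d) :
    ∃ 𝒢 : ℕ ⊕ ℕ → MeasurableSpace Ω, (∀ k, 𝒢 k ≤ mΩ) ∧
      Indep (𝒢 (Sum.inl n)) (𝒢 (Sum.inr n)) P ∧
      Measurable[𝒢 (Sum.inl n)] (fun ω => sgdaStep V γ (fun y => U n y ω) x) ∧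
      Measurable[MeasurableSpace.prod inferInstance (𝒢 (Sum.inr n))]
        (fun q : Vec d × Ω => x - (α * γ) • (V q.1 + U' n q.1 q.2)) := by
  obtain ⟨𝒢, hle, hind, hmeas⟩ := h.iid.indep
  refine ⟨𝒢, hle, hind.indep (by simp), ?_, ?_⟩
  · exact measurable_eval_field le_rfl (measurable_const (a := x))
      (measurable_sgdaStep hV (hmeas (Sum.inl n)))
  · exact measurable_const.sub (((hV.comp measurable_fst).add (hmeas (Sum.inr n))).const_smul (α * γ))

variable [IsProbabilityMeasure P]

/-- Equality in law is known for each field separately. Independence within a step makes the law of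
the update an integral, over the law of `U n x`, of a function depending only on the laws of the `U'
n y`. -/
theorem map_segStep_eq {time : ℕ ⊕ ℕ → ℕ} (hV : Measurable V)
    (h : OracleNoise P ℱ time (Sum.elim U U') σ) (n : ℕ) (x : Vec d) :
    P.map (fun ω => segStep V α γ (fun y => U n y ω) (fun y => U' n y ω) x)
      = P.map (fun ω => segStep V α γ (fun y => U 0 y ω) (fun y => U' 0 y ω) x) := by
  have hU (n : ℕ) : Measurable fun q : Vec d × Ω => U n q.1 q.2 := h.measurable_field (Sum.inl n)
  have hU' (n : ℕ) : Measurable fun q : Vec d × Ω => U' n q.1 q.2 := h.measurable_field (Sum.inr n)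
  ext A hA
  set g : ℕ → Vec d → ℝ≥0∞ := fun n y => P {ω | x - (α * γ) • (V y + U' n y ω) ∈ A} with hg
  have hga (y : Vec d) : Measurable fun z : Vec d => x - (α * γ) • (V y + z) := by fun_prop
  have hgeq (n : ℕ) : g n = g 0 := by
    have e (n : ℕ) (y : Vec d) :
        g n y = P.map (U' n y) ((fun z => x - (α * γ) • (V y + z)) ⁻¹' A) := by
      have hm : Measurable (U' n y) := h.measurable_apply (Sum.inr n) y
      rw [Measure.map_apply hm (hga y hA)]
      rfl
    ext y
    rw [e, e]
    exact congrArg (fun m : Measure (Vec d) => m _) (h.iid.map_eq (Sum.inr n) (Sum.inr 0) y)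
  have hF (n : ℕ) : Measurable fun q : Vec d × Ω => x - (α * γ) • (V q.1 + U' n q.1 q.2) :=
    measurable_const.sub (((hV.comp measurable_fst).add (hU' n)).const_smul (α * γ))
  have hgm (n : ℕ) : Measurable (g n) := measurable_measure_prodMk_left (hF n hA)
  have hza : Measurable fun z : Vec d => x - γ • (V x + z) := by fun_prop
  have key (n : ℕ) : P.map (fun ω => segStep V α γ (fun y => U n y ω) (fun y => U' n y ω) x) A
      = ∫⁻ z, g 0 (x - γ • (V x + z)) ∂P.map (U n x) := by
    obtain ⟨𝒢, hle, hind, hY, hD⟩ := h.exists_seg_decoupling (α := α) (γ := γ) hV n x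
    have hs : Measurable fun ω => segStep V α γ (fun y => U n y ω) (fun y => U' n y ω) x :=
      (measurable_segStep hV (hU n) (hU' n)).comp measurable_prodMk_left
    have hm : Measurable (U n x) := h.measurable_apply (Sum.inl n) x
    have hgz : Measurable fun z => g 0 (x - γ • (V x + z)) := (hgm 0).comp hza
    rw [Measure.map_apply hs hA, lintegral_map hgz hm, ← hgeq n]
    exact measure_decouple (hle _) (hle _) hind hY (hD hA)
  rw [key n, key 0]
  exact congrArg (fun m : Measure (Vec d) => ∫⁻ z, g 0 (x - γ • (V x + z)) ∂m)
    (h.iid.map_eq (Sum.inl n) (Sum.inl 0) x)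

theorem map_seg_eq_evolve {time : ℕ ⊕ ℕ → ℕ} (hV : Measurable V)
    (h : OracleNoise P ℱ time (Sum.elim U U') σ) (x₀ : Vec d) (n : ℕ) :
    Measurable (seg V α γ U U' x₀ n) ∧
      P.map (seg V α γ U U' x₀ n) = evolve (segKernel P V α γ U U') (Measure.dirac x₀) n := by
  obtain ⟨𝒢, hle, hind, hmeas⟩ := h.iid.indep
  refine map_iterate_eq_evolve (𝒜 := fun n => 𝒢 (Sum.inl n) ⊔ 𝒢 (Sum.inr n))
    (F := fun n x ω => segStep V α γ (fun y => U n y ω) (fun y => U' n y ω) x)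
    (fun n => sup_le (hle _) (hle _)) (fun n => ?_) (fun n => ?_) (fun n x => ?_) rfl
    (fun n => rfl) n
  · have hST : Disjoint {k : ℕ ⊕ ℕ | Sum.elim id id k < n} {k : ℕ ⊕ ℕ | Sum.elim id id k = n} :=
      Set.disjoint_left.2 fun k (hk : _ < n) (hk' : _ = n) => hk.ne hk'
    refine indep_of_indep_of_le_right (indep_of_indep_of_le_left
      (indep_iSup_of_disjoint hle hind hST) ?_) ?_
    · exact iSup₂_le fun k hk => sup_le
        (le_iSup₂_of_le (f := fun i (_ : i ∈ {k : ℕ ⊕ ℕ | Sum.elim id id k < n}) => 𝒢 i)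
          (Sum.inl k) hk le_rfl)
        (le_iSup₂_of_le (f := fun i (_ : i ∈ {k : ℕ ⊕ ℕ | Sum.elim id id k < n}) => 𝒢 i)
          (Sum.inr k) hk le_rfl)
    · exact sup_le
        (le_iSup₂_of_le (f := fun i (_ : i ∈ {k : ℕ ⊕ ℕ | Sum.elim id id k = n}) => 𝒢 i)
          (Sum.inl n) rfl le_rfl)
        (le_iSup₂_of_le (f := fun i (_ : i ∈ {k : ℕ ⊕ ℕ | Sum.elim id id k = n}) => 𝒢 i)
          (Sum.inr n) rfl le_rfl)
  · refine measurable_segStep hV ((hmeas (Sum.inl n)).mono ?_ le_rfl)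
      ((hmeas (Sum.inr n)).mono ?_ le_rfl)
    · exact sup_le_sup le_rfl (MeasurableSpace.comap_mono le_sup_left)
    · exact sup_le_sup le_rfl (MeasurableSpace.comap_mono le_sup_right)
  · rw [segKernel, updateKernel_apply
      (measurable_segStep hV (h.measurable_field (Sum.inl 0)) (h.measurable_field (Sum.inr 0)))]
    exact map_segStep_eq hV h n x

/-- One extragradient step is contracting up to the monotonicity defect and the noise `z` of the
look-ahead step. -/
theorem sq_norm_sub_smul_lookahead_le {L : ℝ≥0} (hL : LipschitzWith L V) {lam μ : ℝ} (hμ : 0 < μ)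
    {xs : Vec d} (hxs : ∀ x, μ * ‖x - xs‖ ^ 2 - lam ≤ inner ℝ (V x) (x - xs)) (hα0 : 0 < α)
    (hα1 : α < 1) (hγ : 0 < γ) (hγμ : γ < 1 / (2 * μ + √3 * L)) (x z : Vec d) :
    ‖x - xs - (α * γ) • V (x - γ • (V x + z))‖ ^ 2
      ≤ (1 - α * γ * μ) * ‖x - xs‖ ^ 2 + 2 * α * γ * lam + 3 / 2 * α * γ ^ 2 * ‖z‖ ^ 2 := by
  set g := V x + z with hg
  set y := x - γ • g with hy
  set v := V y with hv
  have hxy : x - y = γ • g := by rw [hy]; abel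
  have hden : 0 < 2 * μ + √3 * L := by positivity
  have hstep : γ * (2 * μ + √3 * L) < 1 := (lt_div_iff₀ hden).1 hγμ
  -- expansion of the square
  have e1 : ‖x - xs - (α * γ) • v‖ ^ 2
      = ‖x - xs‖ ^ 2 - 2 * (α * γ) * inner ℝ v (x - xs) + (α * γ) ^ 2 * ‖v‖ ^ 2 := by
    rw [norm_sub_sq_real, real_inner_smul_right, norm_smul, mul_pow, Real.norm_eq_abs, sq_abs,
      real_inner_comm]
    ring
  have e2 : inner ℝ v (x - xs) = inner ℝ v (y - xs) + γ * inner ℝ v g := by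
    rw [← real_inner_smul_right, ← hxy, ← inner_add_right]
    congr 1
    abel
  have e3 : ‖v - g‖ ^ 2 = ‖v‖ ^ 2 - 2 * inner ℝ v g + ‖g‖ ^ 2 := norm_sub_sq_real v g
  -- Lipschitz continuity
  have h1 : ‖v - g‖ ^ 2 ≤ 3 * (L ^ 2 * γ ^ 2 * ‖g‖ ^ 2) + 3 / 2 * ‖z‖ ^ 2 := by
    have h2 : ‖v - V x‖ ≤ L * (γ * ‖g‖) := by
      have := hL.dist_le_mul y x
      rwa [dist_eq_norm, dist_comm, dist_eq_norm, hxy, norm_smul, Real.norm_of_nonneg hγ.le]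
        at this
    have h3 : ‖v - g‖ ≤ L * (γ * ‖g‖) + ‖z‖ := by
      have : v - g = (v - V x) - z := by rw [hg]; abel
      rw [this]
      exact (norm_sub_le _ _).trans (by linarith)
    have h4 := pow_le_pow_left₀ (norm_nonneg _) h3 2
    -- The weights `3` and `3/2` in splitting the square are where the `√3` of the step-size
    -- condition comes from.
    nlinarith [sq_nonneg (2 * (L * (γ * ‖g‖)) - ‖z‖)]
  -- comparison of `x` and `y`
  have h5 : ‖x - xs‖ ^ 2 ≤ 2 * ‖y - xs‖ ^ 2 + 2 * (γ ^ 2 * ‖g‖ ^ 2) := by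
    have h6 : ‖x - xs‖ ≤ ‖y - xs‖ + γ * ‖g‖ := by
      have h7 := norm_add_le (y - xs) (x - y)
      rw [hxy, norm_smul, Real.norm_of_nonneg hγ.le, ← hxy] at h7
      rwa [show y - xs + (x - y) = x - xs by abel] at h7
    have h8 := pow_le_pow_left₀ (norm_nonneg _) h6 2
    nlinarith [sq_nonneg (‖y - xs‖ - γ * ‖g‖)]
  -- This is the total coefficient of `αγ²‖g‖²`. With `s = √3 γL` it is `s² + 2γμ - 1`, and `s < 1`
  -- gives `s² ≤ s`.
  have hcoef : 3 * (L ^ 2 * γ ^ 2) + 2 * (γ * μ) - 1 ≤ 0 := by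
    set s := γ * (√3 * L) with hs
    have hs0 : 0 ≤ s := by positivity
    have hs2 : s ^ 2 = 3 * (L ^ 2 * γ ^ 2) := by
      rw [hs, mul_pow, mul_pow, Real.sq_sqrt (by norm_num)]; ring
    have h9 : 2 * (γ * μ) + s < 1 := by rw [hs]; linarith
    have h10 : 0 < γ * μ := mul_pos hγ hμ
    nlinarith
  have hαγ : 0 < α * γ := mul_pos hα0 hγ
  have m1 := mul_le_mul_of_nonneg_left (hxs y) hαγ.le
  have m2 := mul_le_mul_of_nonneg_left h1 (show 0 ≤ α * γ ^ 2 by positivity)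
  have m3 := mul_le_mul_of_nonneg_left h5 (mul_pos hαγ hμ).le
  have m4 : α * γ ^ 2 * ‖g‖ ^ 2 * (3 * (L ^ 2 * γ ^ 2) + 2 * (γ * μ) - 1) ≤ 0 :=
    mul_nonpos_of_nonneg_of_nonpos (by positivity) hcoef
  have m5 : 0 ≤ α * (1 - α) * (γ ^ 2 * ‖v‖ ^ 2) :=
    mul_nonneg (mul_nonneg hα0.le (by linarith)) (by positivity)
  rw [e1, e2]
  -- Polarization: the resulting `-αγ²‖v‖²` dominates `α²γ²‖v‖²` because `α < 1`.
  have e4 : 2 * (α * γ) * (γ * inner ℝ v g)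
      = α * γ ^ 2 * (‖v‖ ^ 2 + ‖g‖ ^ 2 - ‖v - g‖ ^ 2) := by rw [e3]; ring
  linarith

theorem geometricDrift_seg {time : ℕ ⊕ ℕ → ℕ} (h : OracleNoise P ℱ time (Sum.elim U U') σ)
    {L : ℝ≥0} (hL : LipschitzWith L V) {lam μ : ℝ} (hlam : 0 ≤ lam) (hμ : 0 < μ)
    {xs : Vec d} (hxs : ∀ x, μ * ‖x - xs‖ ^ 2 - lam ≤ inner ℝ (V x) (x - xs)) (hα0 : 0 < α)
    (hα1 : α < 1) (hγ : 0 < γ) (hγμ : γ < 1 / (2 * μ + √3 * L)) :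
    GeometricDrift (segKernel P V α γ U U') (fun x => ‖x - xs‖ ^ 2) (1 - α * γ * μ)
      (2 * α * γ * lam + 3 / 2 * α * γ ^ 2 * σ ^ 2 + (α * γ) ^ 2 * σ ^ 2) := by
  have hV : Measurable V := hL.continuous.measurable
  have hstep := measurable_segStep (α := α) (γ := γ) hV (h.measurable_field (Sum.inl 0))
    (h.measurable_field (Sum.inr 0))
  have hm : Measurable fun x : Vec d => ‖x - xs‖ ^ 2 := by fun_prop
  have hsx (x : Vec d) :
      Measurable fun ω => segStep V α γ (fun y => U 0 y ω) (fun y => U' 0 y ω) x :=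
    hstep.comp measurable_prodMk_left
  have hκ : 0 ≤ 1 - α * γ * μ := by
    have h1 : γ * (2 * μ + √3 * L) < 1 := (lt_div_iff₀ (by positivity)).1 hγμ
    have h2 : 0 ≤ γ * (√3 * L) := by positivity
    have h3 : 0 < γ * μ := mul_pos hγ hμ
    nlinarith
  have key (x : Vec d) := integrable_and_integral_le_of_lintegral_le (P := P)
    (g := fun ω => ‖segStep V α γ (fun y => U 0 y ω) (fun y => U' 0 y ω) x - xs‖ ^ 2)
    (hm.comp (hsx x)) (fun ω => by positivity)
    (c := (1 - α * γ * μ) * ‖x - xs‖ ^ 2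
      + (2 * α * γ * lam + 3 / 2 * α * γ ^ 2 * σ ^ 2 + (α * γ) ^ 2 * σ ^ 2))
    (by positivity) (by
    obtain ⟨𝒢, hle, hind, hY, hD⟩ := h.exists_seg_decoupling (α := α) (γ := γ) hV 0 x
    -- Average over the second noise at a frozen look-ahead point, where it has zero mean, and only
    -- then over the first noise. Working with `lintegral` yields integrability along with the
    -- bound.
    refine (lintegral_decouple (hle _) (hle _) hind hY ((hm.comp hD).ennreal_ofReal)).trans_le ?_
    have hu2 : Integrable (fun ω => ‖U 0 x ω‖ ^ 2) P :=
      (memLp_two_iff_integrable_sq_norm (h.sq_integrable (Sum.inl 0) x).1).1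
        (h.sq_integrable (Sum.inl 0) x)
    have hinner (y : Vec d) :
        ∫⁻ ω, ENNReal.ofReal (‖x - (α * γ) • (V y + U' 0 y ω) - xs‖ ^ 2) ∂P
          ≤ ENNReal.ofReal (‖x - xs - (α * γ) • V y‖ ^ 2 + (α * γ) ^ 2 * σ ^ 2) := by
      have hk := integrable_and_integral_sq_norm_sub_smul_le (h.sq_integrable (Sum.inr 0) y)
        (h.integral_eq_zero (Sum.inr 0) y) (h.integral_sq_le (Sum.inr 0) y)
        (x - xs - (α * γ) • V y) (α * γ)
      have he (ω : Ω) : x - xs - (α * γ) • V y - (α * γ) • Sum.elim U U' (Sum.inr 0) y ω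
          = x - (α * γ) • (V y + U' 0 y ω) - xs := by
        rw [smul_add, Sum.elim_inr]; abel
      simp only [he] at hk
      rw [← ofReal_integral_eq_lintegral_ofReal hk.1 (ae_of_all _ fun ω => by positivity)]
      exact ENNReal.ofReal_le_ofReal hk.2
    have hi : Integrable (fun ω => ((1 - α * γ * μ) * ‖x - xs‖ ^ 2 + 2 * α * γ * lam
        + (α * γ) ^ 2 * σ ^ 2) + 3 / 2 * α * γ ^ 2 * ‖U 0 x ω‖ ^ 2) P :=
      (integrable_const _).add (hu2.const_mul _)
    calc _ ≤ ∫⁻ ω, ENNReal.ofReal (((1 - α * γ * μ) * ‖x - xs‖ ^ 2 + 2 * α * γ * lam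
          + (α * γ) ^ 2 * σ ^ 2) + 3 / 2 * α * γ ^ 2 * ‖U 0 x ω‖ ^ 2) ∂P := by
          refine lintegral_mono fun ω => (hinner _).trans (ENNReal.ofReal_le_ofReal ?_)
          have := sq_norm_sub_smul_lookahead_le hL hμ hxs hα0 hα1 hγ hγμ x (U 0 x ω)
          change ‖x - xs - (α * γ) • V (x - γ • (V x + U 0 x ω))‖ ^ 2 + (α * γ) ^ 2 * σ ^ 2 ≤ _
          linarith
      _ ≤ _ := by
          rw [← ofReal_integral_eq_lintegral_ofReal hi (ae_of_all _ fun ω => by positivity),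
            integral_add (integrable_const _) (hu2.const_mul _), integral_const_mul]
          refine ENNReal.ofReal_le_ofReal ?_
          simp only [integral_const, probReal_univ, smul_eq_mul, one_mul]
          have := mul_le_mul_of_nonneg_left (h.integral_sq_le (Sum.inl 0) x)
            (show 0 ≤ 3 / 2 * α * γ ^ 2 by positivity)
          simp only [Sum.elim_inl] at this
          linarith)
  refine ⟨hm, fun x => by positivity, fun x => ?_, fun x => ?_⟩
  · rw [segKernel, updateKernel_apply hstep,
      integrable_map_measure hm.aestronglyMeasurable (hsx x).aemeasurable]
    exact (key x).1
  · rw [segKernel, updateKernel_apply hstep,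
      integral_map (hsx x).aemeasurable hm.aestronglyMeasurable]
    exact (key x).2

theorem overlapOn_seg {time : ℕ ⊕ ℕ → ℕ} (h : OracleNoise P ℱ time (Sum.elim U U') σ)
    (hp : PositiveDensityPart P (Sum.elim U U')) {L : ℝ≥0} (hL : LipschitzWith L V) (hα : 0 < α)
    (hγ : 0 < γ) (xs : Vec d) (r : ℝ) :
    ∃ δ, 0 < δ ∧ OverlapOn (segKernel P V α γ U U') {x | ‖x - xs‖ ^ 2 ≤ r} δ := by
  have hV : Measurable V := hL.continuous.measurable
  have hstep := measurable_segStep (α := α) (γ := γ) hV (h.measurable_field (Sum.inl 0))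
    (h.measurable_field (Sum.inr 0))
  have hVb (x : Vec d) : ‖V x‖ ≤ ‖V 0‖ + L * ‖x‖ := by
    have h1 := hL.dist_le_mul x 0
    rw [dist_zero_right, dist_eq_norm] at h1
    have h2 := norm_add_le (V x - V 0) (V 0)
    rw [sub_add_cancel] at h2
    linarith
  set N : ℝ := max (‖xs‖ + 1 + r) 0 with hN
  have hN0 : 0 ≤ N := le_max_right _ _
  -- Chebyshev then puts the first noise in the ball of radius `T` with probability at least `1/2`.
  set T : ℝ := 2 * |σ| + 1 with hT
  have hT0 : 0 < T := by positivity
  set N' : ℝ := N + γ * ((‖V 0‖ + L * N) + T) with hN'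
  have hN'0 : 0 ≤ N' := by positivity
  obtain ⟨δ, hδ, hov⟩ := PositiveDensityPart.exists_overlap_update (u := U' 0)
    (fun _ => hp (Sum.inr 0)) (h.measurable_apply (Sum.inr 0)) (h.sq_integrable (Sum.inr 0))
    (h.integral_sq_le (Sum.inr 0)) (mul_pos hα hγ) (M := N' + (‖V 0‖ + L * N')) (by positivity)
  -- Freeze the look-ahead point at a bounded value `y`. The second noise at `y` alone provides the
  -- overlap, and the factor 2 explains the final `δ / 2`.
  have hmix (x : Vec d) (hx : ‖x - xs‖ ^ 2 ≤ r) (A : Set (Vec d)) (hA : MeasurableSet A) :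
      ‖x‖ ≤ N' + (‖V 0‖ + L * N') ∧ ∃ y : Vec d, ‖y‖ ≤ N' + (‖V 0‖ + L * N') ∧
        ‖V y‖ ≤ N' + (‖V 0‖ + L * N') ∧
        P.real {ω | x - (α * γ) • (V y + U' 0 y ω) ∈ A}
          ≤ 2 * (segKernel P V α γ U U' x).real A := by
    have hxN : ‖x‖ ≤ N := (norm_le_of_sq_norm_sub_le hx).trans (le_max_left _ _)
    have hNN' : N ≤ N' := le_add_of_nonneg_right (by positivity)
    have hpos : 0 ≤ ‖V 0‖ + L * N' := by positivity
    refine ⟨by linarith, ?_⟩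
    have hlarge : 1 / 2 ≤ P.real {ω | ‖U 0 x ω‖ ≤ T} := by
      have hcheb := measureReal_lt_norm_le_div_sq (h.sq_integrable (Sum.inl 0) x)
        (h.integral_sq_le (Sum.inl 0) x) hT0
      have hcompl : P.real {ω | ‖U 0 x ω‖ ≤ T} = 1 - P.real {ω | T < ‖U 0 x ω‖} := by
        have hm : Measurable (U 0 x) := h.measurable_apply (Sum.inl 0) x
        rw [← probReal_compl_eq_one_sub (measurableSet_lt measurable_const hm.norm)]
        congr 1
        ext ω
        simp
      have : σ ^ 2 / T ^ 2 ≤ 1 / 2 := by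
        rw [div_le_iff₀ (by positivity), hT, ← sq_abs σ]
        nlinarith [abs_nonneg σ]
      rw [hcompl]
      simp only [Sum.elim_inl] at hcheb
      linarith
    obtain ⟨𝒢, hle, hind, hY, hD⟩ := h.exists_seg_decoupling (α := α) (γ := γ) hV 0 x
    obtain ⟨ω', hω', hle₂⟩ := exists_measureReal_le_two_mul (hle _) (hle _) hind hY (hD hA) hlarge
    set y := sgdaStep V γ (fun y => U 0 y ω') x with hy
    have hyN : ‖y‖ ≤ N' := by
      have h1 : ‖V x + U 0 x ω'‖ ≤ (‖V 0‖ + L * N) + T := by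
        refine (norm_add_le _ _).trans (add_le_add ((hVb x).trans ?_) hω')
        gcongr
      refine (norm_sub_le _ _).trans (add_le_add hxN ?_)
      rw [norm_smul, Real.norm_of_nonneg hγ.le]
      gcongr
    have hVy : ‖V y‖ ≤ ‖V 0‖ + L * N' := (hVb y).trans (by gcongr)
    refine ⟨y, by linarith, by linarith, ?_⟩
    rw [segKernel, measureReal_updateKernel hstep x hA]
    exact hle₂
  refine ⟨δ / 2, half_pos hδ, fun x hx x' hx' A hA => ?_⟩
  obtain ⟨hxb, y, hy, hVy, hle⟩ := hmix x hx A hA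
  obtain ⟨hxb', y', hy', hVy', hle'⟩ := hmix x' hx' Aᶜ hA.compl
  linarith [hov x y (V y) x' y' (V y') hxb hy hVy hxb' hy' hVy' A hA]

theorem exists_isGeometricLimit_seg {time : ℕ ⊕ ℕ → ℕ}
    (h : OracleNoise P ℱ time (Sum.elim U U') σ) (hp : PositiveDensityPart P (Sum.elim U U'))
    {L : ℝ≥0} (hL : LipschitzWith L V) {lam μ : ℝ} (hlam : 0 ≤ lam) (hμ : 0 < μ)
    (hmon : WeakQuasiStronglyMonotone V lam μ) (hα0 : 0 < α) (hα1 : α < 1) (hγ : 0 < γ)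
    (hγμ : γ < 1 / (2 * μ + √3 * L)) :
    ∃ π : Measure (Vec d), IsGeometricLimit P (segKernel P V α γ U U') (seg V α γ U U') π ∧
      LipschitzBias V π ((6 + (3 + 2 * α) * σ ^ 2) * (max lam γ / μ)) := by
  obtain ⟨xs, hxs, hmon⟩ := hmon
  have hV : Measurable V := hL.continuous.measurable
  have hMarkov : IsMarkovKernel (segKernel P V α γ U U') := isMarkovKernel_updateKernel
    (measurable_segStep hV (h.measurable_field (Sum.inl 0)) (h.measurable_field (Sum.inr 0)))
  have hαγμ : 0 < α * γ * μ := by positivity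
  obtain ⟨π, hπ, hint, hle⟩ := exists_isGeometricLimit
    (geometricDrift_seg h hL hlam hμ hmon hα0 hα1 hγ hγμ) (by linarith) (by positivity)
    (overlapOn_seg h hp hL hα0 hγ xs) (map_seg_eq_evolve hV h)
  have := hπ.prob
  have hmax : 0 < max lam γ := hγ.trans_le (le_max_right _ _)
  refine ⟨π, hπ, lipschitzBias_of_integral_sq_le hint hle
    (fun y hy => sq_norm_sub_le_of_solution hμ hmon hy) (by positivity) ?_⟩
  rw [sub_sub_cancel]
  -- Dividing the drift constant by `αγμ` cancels `αγ`, leaving `(2 lam + (3/2 + α) σ² γ) / μ`; this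
  -- is doubled, and `2 lam / μ` is added for the distance to other solutions.
  calc _ = (6 * lam + (3 + 2 * α) * σ ^ 2 * γ) / μ := by
        field_simp
        ring
    _ ≤ (6 * max lam γ + (3 + 2 * α) * σ ^ 2 * max lam γ) / μ := by
        gcongr
        · exact le_max_left _ _
        · exact le_max_right _ _
    _ = _ := by ring

end SEG

end StochVI

theorem mainTheorem1 :
    -- SGDA
    (∀ G R σ : ℝ, 0 < G → 0 < σ → ∃ K : ℝ, 0 < K ∧
      ∀ (d : ℕ) (V : StochVI.Vec d → StochVI.Vec d) (lam μ γ : ℝ),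
        Measurable V →
        (∃ xs ∈ StochVI.solutions V, ‖xs‖ ≤ R) →
        0 ≤ lam → 0 < μ → StochVI.WeakQuasiStronglyMonotone V lam μ →
        StochVI.LinearGrowth V G →
        0 < γ → γ < μ / G ^ 2 →
        ∀ (Ω : Type u) [mΩ : MeasurableSpace Ω] (P : MeasureTheory.Measure Ω)
          [MeasureTheory.IsProbabilityMeasure P] (ℱ : MeasureTheory.Filtration ℕ mΩ)
          (U : ℕ → StochVI.Vec d → Ω → StochVI.Vec d),
          StochVI.OracleNoise P ℱ id U σ →
          StochVI.PositiveDensityPart P U →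
          ∃ π : MeasureTheory.Measure (StochVI.Vec d),
            StochVI.IsGeometricLimit P (StochVI.sgdaKernel P V γ U) (StochVI.sgda V γ U) π ∧
            StochVI.LipschitzBias V π (K * (max lam γ / μ))) ∧
    -- SEG
    (∀ α σ : ℝ, 0 < α → α < 1 → 0 < σ → ∃ K : ℝ, 0 < K ∧
      ∀ (d : ℕ) (V : StochVI.Vec d → StochVI.Vec d) (L : NNReal) (R lam μ γ : ℝ),
        (∃ xs ∈ StochVI.solutions V, ‖xs‖ ≤ R) →
        0 ≤ lam → 0 < μ → StochVI.WeakQuasiStronglyMonotone V lam μ →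
        LipschitzWith L V →
        0 < γ → γ < 1 / (2 * μ + √3 * L) →
        ∀ (Ω : Type u) [mΩ : MeasurableSpace Ω] (P : MeasureTheory.Measure Ω)
          [MeasureTheory.IsProbabilityMeasure P] (ℱ : MeasureTheory.Filtration ℕ mΩ)
          (U U' : ℕ → StochVI.Vec d → Ω → StochVI.Vec d),
          StochVI.OracleNoise P ℱ (Sum.elim id id) (Sum.elim U U') σ →
          StochVI.PositiveDensityPart P (Sum.elim U U') →
          ∃ π : MeasureTheory.Measure (StochVI.Vec d),
            StochVI.IsGeometricLimit P (StochVI.segKernel P V α γ U U')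
              (StochVI.seg V α γ U U') π ∧
            StochVI.LipschitzBias V π (K * (max lam γ / μ))) := by
  constructor
  · intro G R σ hG hσ
    -- `K` is fixed before the dimension, the operator, `lam`, `μ` and `γ`, which is how its
    -- independence of them is expressed.
    refine ⟨24 * G ^ 2 * (1 + |R|) ^ 2 + 34 + 4 * σ ^ 2, by positivity, ?_⟩
    intro d V lam μ γ hV hR hlam hμ hmon hVG hγ hγμ Ω _ P _ ℱ U hU hp
    exact StochVI.exists_isGeometricLimit_sgda hV hG hR hlam hμ hmon hVG hγ hγμ hU hp
  · intro α σ hα0 hα1 hσ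
    refine ⟨6 + (3 + 2 * α) * σ ^ 2, by positivity, ?_⟩
    intro d V L R lam μ γ _ hlam hμ hmon hL hγ hγμ Ω _ P _ ℱ U U' hU hp
    exact StochVI.exists_isGeometricLimit_seg hU hp hL hlam hμ hmon hα0 hα1 hγ hγμ
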